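/- **Setting.** For each $I=1,2,\dots$ consider a matched study with $I$ matched sets; set $i$ has $n_i\ge 2$ units, exactly one of which is treated. All quantities below may depend on $I$, and $I$ is suppressed in the notation. The potential outcomes $Y_{ij}(1),Y_{ij}(0)\in\mathbb R$ are fixed, and the randomness comes only from the assignment $\bm Z\in\mathcal Z=\{\bm z\in\{0,1\}^N:\sum_j z_{ij}=1\ \forall i\}$, $N=\sum_i n_i$, which is independent across sets: $\mathbb P(\bm Z=\bm z)=\prod_i\prod_j (p^\star_{ij})^{z_{ij}}$, where $p^\star_{ij}\ge 0$ and $\sum_j p^\star_{ij}=1$. The observed outcomes are $Y_{ij}=Z_{ij}Y_{ij}(1)+(1-Z_{ij})Y_{ij}(0)$. The hidden bias of set $i$ is $\Gamma^\star_i=\max_j p^\star_{ij}/\min_j p^\star_{ij}\in[1,\infty]$, and $\Gamma^\star_{(1)}\le\dots\le\Gamma^\star_{(I)}$ are the sorted biases. Let $1\le k\le I$ and $\Gamma_0\in[1,\infty)$ (both may vary with $I$), and let $\mathcal I^\star_k$ be the set of indices of the $k$ sets with the smallest hidden biases (ties broken in any way). **Test statistic.** Let $t(\bm z,\bm y)=\sum_i\sum_j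 z_{ij}q_{ij}$, where $q_{ij}=q_{ij}(\bm y)$ are arbitrary real functions of $\bm y\in\mathbb R^N$, and $T=t(\bm Z,\bm Y)$. With $\circ$ the entrywise product and $\succcurlyeq$ the entrywise order, $t$ is *effect increasing* if $t(\bm z,\bm y+\bm z\circ\bm\eta+(\bm 1-\bm z)\circ\bm\xi)\ge t(\bm z,\bm y)$ for all $\bm z\in\mathcal Z$, $\bm y$ and $\bm\eta\succcurlyeq\bm 0\succcurlyeq\bm\xi$; it is *differential increasing* if $t(\bm z,\bm y+\bm a\circ\bm\eta)-t(\bm z,\bm y)\le t(\bm a,\bm y+\bm a\circ\bm\eta)-t(\bm a,\bm y)$ for all $\bm z,\bm a\in\mathcal Z$, $\bm y$ and $\bm\eta\succcurlyeq\bm 0$. **The $p$-value.** In everything that follows put $q_{ij}=q_{ij}(\bm Y)$, i.e. treat the observed $\bm Y$ as if it were the fixed vector of control potential outcomes. The sensitivity model with bias $\Gamma<\infty$ in set $i$ consists of the treatment probabilities $\Gamma^{u_j}/\sum_l\Gamma^{u_l}$ with $u\in[0,1]^{n_i}$; for $\Gamma=\infty$ it consists of all probability vectors. Let $\mu_i(\Gamma)$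 be the maximum over this model of the mean of $T_i=\sum_j Z_{ij}q_{ij}$, and $v_i^2(\Gamma)$ the maximum of its variance over the elements of the model that maximize the mean. For $\mathcal I\subseteq\{1,\dots,I\}$ put $$\mu(\Gamma_0;\mathcal I)=\sum_{i\in\mathcal I}\mu_i(\Gamma_0)+\sum_{i\notin\mathcal I}\mu_i(\infty),\qquad \sigma^2(\Gamma_0;\mathcal I)=\sum_{i\in\mathcal I}v_i^2(\Gamma_0)+\sum_{i\notin\mathcal I}v_i^2(\infty),$$ $$\mu(\Gamma_0;k)=\max_{|\mathcal I|=k}\mu(\Gamma_0;\mathcal I),\qquad \sigma^2(\Gamma_0;k)=\max_{|\mathcal I|=k,\ \mu(\Gamma_0;\mathcal I)=\mu(\Gamma_0;k)}\sigma^2(\Gamma_0;\mathcal I).$$ Let $\tilde p_{\Gamma_0;k}=\tilde G(T)\,\mathbb 1\{T\ge\mu(\Gamma_0;k)\}+\mathbb 1\{T<\mu(\Gamma_0;k)\}$, where $\tilde G(c)=\mathbb P(\tilde T\ge c)$ for $\tilde T\sim\mathcal N(\mu(\Gamma_0;k),\sigma^2(\Gamma_0;k))$ (a point mass if the variance is $0$).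 **Regularity conditions (with imputed outcomes, in probability).** Let $R_i=\max_j q_{ij}-\min_j q_{ij}$, and let $\mu_i=\sum_j p^\star_{ij}q_{ij}$ and $v_i^2=\sum_j p^\star_{ij}(q_{ij}-\mu_i)^2$ (with $\bm Y$ held fixed). Let $\Gamma_i=\Gamma_0$ for $i\in\mathcal I^\star_k$, $\Gamma_i=\infty$ otherwise, and $\mathcal A=\{i:v_i^2>v_i^2(\Gamma_i)\}$; let $\Delta_\mu$ and $\Delta_{v^2}$ be the averages over $i\in\mathcal A$ of $\mu_i(\Gamma_i)-\mu_i$ and of $v_i^2-v_i^2(\Gamma_i)$. Rank the sets increasingly by $\mu_i(\infty)-\mu_i(\Gamma_0)$, where among tied sets one with smaller $v_i^2(\Gamma_0)$ gets the larger rank (remaining ties broken in any way), and let $\mathcal I_{\Gamma_0;k}$ be the $k$ sets of smallest rank. Let $\mathcal B=\{(i,j): i\in\mathcal I_{\Gamma_0;k}\setminus\mathcal I^\star_k,\ j\in\mathcal I^\star_k\setminus\mathcal I_{\Gamma_0;k},\ v_i^2(\Gamma_0)<v_j^2(\Gamma_0)\}$, and let $\Delta_\mu(\Gamma_0;k)$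 and $\Delta_{v^2}(\Gamma_0;k)$ be the averages over $(i,j)\in\mathcal B$ of $\{\mu_j(\infty)-\mu_j(\Gamma_0)\}-\{\mu_i(\infty)-\mu_i(\Gamma_0)\}$ and of $v_j^2(\Gamma_0)-v_i^2(\Gamma_0)$. The conditions are that, in probability as $I\to\infty$, 1. $\max_i R_i^2\big/\sum_{i=1}^I R_i^2/(n_i\Gamma_i^\star)^3\to 0$ (the ratio is read as $\infty$ if its denominator is $0$); 2. $(\Delta_\mu/\Delta_{v^2})\sqrt{\sum_{i=1}^I R_i^2/(n_i\Gamma_i^\star)^3}\to\infty$ (read as $\infty$ if $\mathcal A=\emptyset$); 3. $(\Delta_\mu(\Gamma_0;k)/\Delta_{v^2}(\Gamma_0;k))\sqrt{\sum_{i\in\mathcal I_k^\star}R_i^2/(n_i\Gamma_0)^3}\to\infty$ (read as $\infty$ if $\mathcal B=\emptyset$). Here $R_i^2/(n_i\Gamma^\star_i)^3=0$ if $\Gamma^\star_i=\infty$. **Theorem.** Suppose that for every $I$ the bounded null hypothesis holds ($Y_{ij}(1)\le Y_{ij}(0)$ for all $i,j$), $\Gamma^\star_{(k)}\le\Gamma_0$,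 and $t$ is effect increasing or differential increasing, and that conditions 1–3 hold. Then $\tilde p_{\Gamma_0;k}$, although computed as if Fisher's null held, is an asymptotically valid $p$-value: for every $\alpha\in(0,1)$, $$\limsup_{I\to\infty}\mathbb P(\tilde p_{\Gamma_0;k}\le\alpha)\le\alpha.$$ -/

import Mathlib

open Filter Topology
open scoped ENNReal

noncomputable section

/-! ## Sensitivity models within one matched set of `n` units -/

/-- `p` is a probability vector: `p j` is the probability that unit `j` is the treated one. -/
def IsProbVec {n : ℕ} (p : Fin n → ℝ) : Prop :=
  (∀ j, 0 ≤ p j) ∧ ∑ j, p j = 1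

/-- The hidden bias `max_j p_j / min_j p_j ∈ [1, ∞]` of a set with treatment probabilities `p`;
it is `∞` when some `p_j` vanishes (division by zero in `ℝ≥0∞`, the numerator is positive). -/
def hiddenBias {n : ℕ} (p : Fin n → ℝ) : ℝ≥0∞ :=
  ENNReal.ofReal (⨆ j, p j) / ENNReal.ofReal (⨅ j, p j)

/-- Treatment probabilities under bias `Γ ∈ [1, ∞)` and hidden confounding `u`:
`exp (γ u_j) / ∑_l exp (γ u_l)`, where `γ = log Γ`. -/
def sensProb {n : ℕ} (Γ : ℝ) (u : Fin n → ℝ) (j : Fin n) : ℝ :=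
  Real.exp (Real.log Γ * u j) / ∑ l, Real.exp (Real.log Γ * u l)

/-- The treatment probabilities allowed by the sensitivity model with bias `Γ ∈ [1, ∞]`: those
given by some `u ∈ [0, 1]^n` if `Γ < ∞`, and no restriction at all if `Γ = ∞`. -/
def SensModels (n : ℕ) (Γ : ℝ≥0∞) : Set (Fin n → ℝ) :=
  {p | (Γ = ⊤ ∧ IsProbVec p) ∨
    (Γ ≠ ⊤ ∧ ∃ u : Fin n → ℝ, (∀ j, u j ∈ Set.Icc (0 : ℝ) 1) ∧ p = sensProb Γ.toReal u)}

/-- Mean of the set statistic, which takes the value `c j` with probability `p j`. -/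
def setMean {n : ℕ} (p c : Fin n → ℝ) : ℝ := ∑ j, p j * c j

/-- Variance of the set statistic, which takes the value `c j` with probability `p j`. -/
def setVar {n : ℕ} (p c : Fin n → ℝ) : ℝ := ∑ j, p j * (c j - setMean p c) ^ 2

/-- Maximal mean `μ_i(Γ)` of the set statistic when the bias of the set is at most `Γ`. -/
def maxMean {n : ℕ} (c : Fin n → ℝ) (Γ : ℝ≥0∞) : ℝ :=
  sSup {m | ∃ p ∈ SensModels n Γ, m = setMean p c}

/-- Maximal variance `v_i²(Γ)` of the set statistic among the models that maximize the mean. -/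
def maxVar {n : ℕ} (c : Fin n → ℝ) (Γ : ℝ≥0∞) : ℝ :=
  sSup {v | ∃ p ∈ SensModels n Γ, setMean p c = maxMean c Γ ∧ v = setVar p c}

/-- Range `R_i` of the set statistic. -/
def setRange {n : ℕ} (c : Fin n → ℝ) : ℝ := (⨆ j, c j) - ⨅ j, c j

/-! ## Order statistics -/

/-- `x_(k)`, the `k`-th smallest coordinate of `x`, for `1 ≤ k ≤ I`. -/
def orderStat {I : ℕ} (x : Fin I → ℝ≥0∞) (k : ℕ) : ℝ≥0∞ :=
  if h : k - 1 < I then x (Tuple.sort x ⟨k - 1, h⟩) else ⊤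

/-- `K` consists of the indices of `k` smallest coordinates of `x` (for some way of breaking
ties). -/
def IsKSmallest {I : ℕ} (x : Fin I → ℝ≥0∞) (k : ℕ) (K : Finset (Fin I)) : Prop :=
  K.card = k ∧ ∀ i ∈ K, ∀ j ∉ K, x i ≤ x j

/-! ## Matched studies -/

/-- A matched study with `I` matched sets; set `i` has `n i ≥ 2` units, exactly one of which is
treated. The potential outcomes `Y1`, `Y0` are fixed; `p i j` is the true probability that unit `j`
is the treated unit of set `i`. -/
structure MatchedStudy (I : ℕ) where
  n : Fin I → ℕ
  two_le_n : ∀ i, 2 ≤ n i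
  Y1 : ∀ i, Fin (n i) → ℝ
  Y0 : ∀ i, Fin (n i) → ℝ
  p : ∀ i, Fin (n i) → ℝ
  isProbVec_p : ∀ i, IsProbVec (p i)

namespace MatchedStudy

variable {I : ℕ} (S : MatchedStudy I)

/-- Outcome vectors `y ∈ ℝ^N`, `N = ∑ n_i`. -/
abbrev Outcome : Type := ∀ i, Fin (S.n i) → ℝ

/-- Treatment assignments with exactly one treated unit in each set: `a i` is the treated unit of
set `i`. -/
abbrev Assignment : Type := ∀ i, Fin (S.n i)

/-- Scores `q_{ij}`: arbitrary functions of the whole outcome vector. -/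
abbrev Scores : Type := S.Outcome → ∀ i, Fin (S.n i) → ℝ

/-- The 0-1 vector `z` of an assignment. -/
def z (a : S.Assignment) : S.Outcome := fun i j => if a i = j then 1 else 0

/-- The true assignment mechanism: independent across sets, with probabilities `p i` in set `i`. -/
def law (a : S.Assignment) : ℝ := ∏ i, S.p i (a i)

/-- Probability, over the random assignment, of an event. -/
def prob (E : Set S.Assignment) : ℝ := ∑ a, E.indicator S.law a

/-- Observed outcomes under the assignment `a`. -/
def observed (a : S.Assignment) : S.Outcome :=
  fun i j => S.z a i j * S.Y1 i j + (1 - S.z a i j) * S.Y0 i j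

/-- The bounded null hypothesis: no unit has a positive treatment effect. -/
def BoundedNull : Prop := ∀ i j, S.Y1 i j ≤ S.Y0 i j

/-- The vector of true hidden biases. -/
def bias (i : Fin I) : ℝ≥0∞ := hiddenBias (S.p i)

variable (q : S.Scores)

/-- The test statistic `t(z, y) = ∑_i ∑_j z_{ij} q_{ij}(y)`. -/
def stat (a : S.Assignment) (y : S.Outcome) : ℝ := ∑ i, ∑ j, S.z a i j * q y i j

/-- Effect increasing statistics. -/
def EffectIncreasing : Prop :=
  ∀ (a : S.Assignment) (y η ξ : S.Outcome), (∀ i j, 0 ≤ η i j) → (∀ i j, ξ i j ≤ 0) →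
    S.stat q a y ≤ S.stat q a (y + S.z a * η + (1 - S.z a) * ξ)

/-- Differential increasing statistics. -/
def DifferentialIncreasing : Prop :=
  ∀ (a b : S.Assignment) (y η : S.Outcome), (∀ i j, 0 ≤ η i j) →
    S.stat q a (y + S.z b * η) - S.stat q a y ≤ S.stat q b (y + S.z b * η) - S.stat q b y

/-! ### The asymptotic p-value, with `y` in the role of the control potential outcomes -/

/-- `μ(Γ₀; K)`: bias at most `Γ₀` in the sets of `K`, unrestricted bias in all other sets. -/
def muOn (y : S.Outcome) (Γ₀ : ℝ) (K : Finset (Fin I)) : ℝ :=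
  ∑ i ∈ K, maxMean (q y i) (ENNReal.ofReal Γ₀) + ∑ i ∈ Kᶜ, maxMean (q y i) ⊤

/-- `σ²(Γ₀; K)`. -/
def varOn (y : S.Outcome) (Γ₀ : ℝ) (K : Finset (Fin I)) : ℝ :=
  ∑ i ∈ K, maxVar (q y i) (ENNReal.ofReal Γ₀) + ∑ i ∈ Kᶜ, maxVar (q y i) ⊤

/-- `μ(Γ₀; k) = max_{|K| = k} μ(Γ₀; K)`. -/
def muK (y : S.Outcome) (Γ₀ : ℝ) (k : ℕ) : ℝ :=
  sSup {m | ∃ K : Finset (Fin I), K.card = k ∧ m = S.muOn q y Γ₀ K}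

/-- `σ²(Γ₀; k)`, the maximum of `σ²(Γ₀; K)` over the `K` with `|K| = k` that maximize
`μ(Γ₀; K)`. -/
def varK (y : S.Outcome) (Γ₀ : ℝ) (k : ℕ) : ℝ :=
  sSup {v | ∃ K : Finset (Fin I),
    K.card = k ∧ S.muOn q y Γ₀ K = S.muK q y Γ₀ k ∧ v = S.varOn q y Γ₀ K}

open Classical in
/-- The asymptotic p-value at the observed assignment `a`, computed as if the observed outcomes
were the control potential outcomes:
`G(T) 1{T ≥ μ(Γ₀; k)} + 1{T < μ(Γ₀; k)}`, where `G` is the tail probability of the normal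
distribution with mean `μ(Γ₀; k)` and variance `σ²(Γ₀; k)` (a point mass if the variance is 0). -/
def pValue (Γ₀ : ℝ) (k : ℕ) (a : S.Assignment) : ℝ :=
  let y := S.observed a
  let T := S.stat q a y
  if S.muK q y Γ₀ k ≤ T then
    (ProbabilityTheory.gaussianReal (S.muK q y Γ₀ k) (S.varK q y Γ₀ k).toNNReal).real (Set.Ici T)
  else 1

/-! ### The quantities in the regularity conditions, with `y` in the role of the control potential
outcomes -/

/-- `∑_i R_i² / (n_i Γ_i⋆)³`; sets of infinite bias contribute `0`. -/
def infoSum (y : S.Outcome) : ℝ :=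
  ∑ i, setRange (q y i) ^ 2 * ((((S.n i : ℝ≥0∞) * S.bias i) ^ 3)⁻¹).toReal

open Classical in
/-- `max_i R_i² / ∑_i R_i² / (n_i Γ_i⋆)³`, read as `∞` if the denominator vanishes. -/
def lindebergRatio (y : S.Outcome) : EReal :=
  if S.infoSum q y = 0 then ⊤
  else (((⨆ i, setRange (q y i) ^ 2) / S.infoSum q y : ℝ) : EReal)

open Classical in
/-- The vector of bounds `Γ₀ 1_K + ∞ 1_{Kᶜ}`. -/
def boundVec (Γ₀ : ℝ) (K : Finset (Fin I)) (i : Fin I) : ℝ≥0∞ :=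
  if i ∈ K then ENNReal.ofReal Γ₀ else ⊤

open Classical in
/-- `A_Γ`: the sets whose true variance exceeds the maximized one. -/
def setA (y : S.Outcome) (Γ : Fin I → ℝ≥0∞) : Finset (Fin I) :=
  {i | maxVar (q y i) (Γ i) < setVar (S.p i) (q y i)}

/-- `Δ_μ(Γ)`. -/
def deltaMu (y : S.Outcome) (Γ : Fin I → ℝ≥0∞) : ℝ :=
  ((S.setA q y Γ).card : ℝ)⁻¹ *
    ∑ i ∈ S.setA q y Γ, (maxMean (q y i) (Γ i) - setMean (S.p i) (q y i))

/-- `Δ_{v²}(Γ)`. -/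
def deltaVar (y : S.Outcome) (Γ : Fin I → ℝ≥0∞) : ℝ :=
  ((S.setA q y Γ).card : ℝ)⁻¹ *
    ∑ i ∈ S.setA q y Γ, (setVar (S.p i) (q y i) - maxVar (q y i) (Γ i))

open Classical in
/-- `Δ_μ(Γ) / Δ_{v²}(Γ) · √(∑_i R_i² / (n_i Γ_i⋆)³)`, read as `∞` if `A_Γ` is empty. -/
def vecRatio (y : S.Outcome) (Γ : Fin I → ℝ≥0∞) : EReal :=
  if S.setA q y Γ = ∅ then ⊤
  else ((S.deltaMu q y Γ / S.deltaVar q y Γ * √(S.infoSum q y) : ℝ) : EReal)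

/-- The loss `μ_i(∞) - μ_i(Γ₀)` by which the sets are ranked. -/
def gap (y : S.Outcome) (Γ₀ : ℝ) (i : Fin I) : ℝ :=
  maxMean (q y i) ⊤ - maxMean (q y i) (ENNReal.ofReal Γ₀)

/-- `J` consists of the `k` sets of smallest rank, when the sets are ranked by
`μ_i(∞) - μ_i(Γ₀)` and, in case of a tie, a set with smaller `v_i²(Γ₀)` gets a larger rank
(remaining ties are broken in any way). -/
def IsSelected (y : S.Outcome) (Γ₀ : ℝ) (k : ℕ) (J : Finset (Fin I)) : Prop :=
  J.card = k ∧ ∀ i ∈ J, ∀ j ∉ J, S.gap q y Γ₀ i < S.gap q y Γ₀ j ∨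
    (S.gap q y Γ₀ i = S.gap q y Γ₀ j ∧
      maxVar (q y j) (ENNReal.ofReal Γ₀) ≤ maxVar (q y i) (ENNReal.ofReal Γ₀))

open Classical in
/-- The set `B` of pairs `(i, j)`, `i ∈ J \ K`, `j ∈ K \ J`, with `v_i²(Γ₀) < v_j²(Γ₀)`. -/
def setB (y : S.Outcome) (Γ₀ : ℝ) (J K : Finset (Fin I)) : Finset (Fin I × Fin I) :=
  {x ∈ (J \ K) ×ˢ (K \ J) |
    maxVar (q y x.1) (ENNReal.ofReal Γ₀) < maxVar (q y x.2) (ENNReal.ofReal Γ₀)}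

/-- The average over `B` of the differences of `μ_i(∞) - μ_i(Γ₀)`. -/
def deltaMuB (y : S.Outcome) (Γ₀ : ℝ) (J K : Finset (Fin I)) : ℝ :=
  ((S.setB q y Γ₀ J K).card : ℝ)⁻¹ *
    ∑ x ∈ S.setB q y Γ₀ J K, (S.gap q y Γ₀ x.2 - S.gap q y Γ₀ x.1)

/-- The average over `B` of the differences of `v_i²(Γ₀)`. -/
def deltaVarB (y : S.Outcome) (Γ₀ : ℝ) (J K : Finset (Fin I)) : ℝ :=
  ((S.setB q y Γ₀ J K).card : ℝ)⁻¹ *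
    ∑ x ∈ S.setB q y Γ₀ J K,
      (maxVar (q y x.2) (ENNReal.ofReal Γ₀) - maxVar (q y x.1) (ENNReal.ofReal Γ₀))

open Classical in
/-- `Δ_μ(Γ₀; k) / Δ_{v²}(Γ₀; k) · √(∑_{i ∈ K} R_i² / (n_i Γ₀)³)`, read as `∞` if `B` is empty. -/
def selRatio (y : S.Outcome) (Γ₀ : ℝ) (J K : Finset (Fin I)) : EReal :=
  if S.setB q y Γ₀ J K = ∅ then ⊤
  else ((S.deltaMuB q y Γ₀ J K / S.deltaVarB q y Γ₀ J K *
    √(∑ i ∈ K, setRange (q y i) ^ 2 / ((S.n i : ℝ) * Γ₀) ^ 3) : ℝ) : EReal)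

end MatchedStudy

/-! ## Sequences of studies -/

/-- The nonnegative random variables `X I`, functions of the assignment in the study with `I` sets,
converge to `0` in probability as `I → ∞`. -/
def TendstoZeroInProb (S : ∀ I : ℕ, MatchedStudy I) (X : ∀ I, (S I).Assignment → EReal) : Prop :=
  ∀ ε : ℝ, 0 < ε → Tendsto (fun I => (S I).prob {a | (ε : EReal) < X I a}) atTop (𝓝 0)

/-- The random variables `X I` converge to `∞` in probability as `I → ∞`. -/
def TendstoTopInProb (S : ∀ I : ℕ, MatchedStudy I) (X : ∀ I, (S I).Assignment → EReal) : Prop :=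
  ∀ M : ℝ, Tendsto (fun I => (S I).prob {a | X I a ≤ (M : EReal)}) atTop (𝓝 0)

/-- The regularity conditions, holding in probability with the control potential outcomes replaced
by the observed outcomes. `K I` is the set of the `k` smallest true hidden biases, and
`J I y` is the set of the `k` smallest ranks at the outcome vector `y`. -/
structure RegularInProb (S : ∀ I : ℕ, MatchedStudy I) (q : ∀ I, (S I).Scores) (Γ₀ : ℕ → ℝ)
    (K : ∀ I, Finset (Fin I)) (J : ∀ I, (S I).Outcome → Finset (Fin I)) : Prop where
  lindeberg : TendstoZeroInProb S fun I a => (S I).lindebergRatio (q I) ((S I).observed a)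
  trueSets : TendstoTopInProb S fun I a =>
    (S I).vecRatio (q I) ((S I).observed a) (MatchedStudy.boundVec (Γ₀ I) (K I))
  selectedSets : TendstoTopInProb S fun I a =>
    (S I).selRatio (q I) ((S I).observed a) (Γ₀ I) (J I ((S I).observed a)) (K I)

end

open MeasureTheory ProbabilityTheory


/-! Fix an assignment `a`, freeze `y = S.observed a` and redraw the assignment as `b`. Under the
bounded null, the probability that `b` gives a statistic at least as large as `a` does, both
computed at the frozen `y`, dominates the exact tail probability of one fixed statistic `X` of the
assignment (`exists_prob_tail_le`), and such tail probabilities are super-uniform (`prob_tail_le`).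
So it suffices that, outside events of vanishing probability, the normal tail defining the p-value
is at least the frozen-outcome tail up to a small error, uniformly in `y`.

With `y` frozen, the statistic is a sum of independent bounded variables. Condition 1 yields a
one-sided central limit theorem, uniform over all such sums (`exists_tail_le_normalTailAt`, by
Lindeberg replacement). The normal tail is then moved from the true mean and variance to those of
the least biased sets `K`, and from there to those of the selected sets `J`, whose mean is `muK`. At
each move the mean can only rise, but the variance may fall. By `normalTailAt_compare` the fall is
harmless when `M * (v₁ - v₂) ≤ √v₁ * (m₂ - m₁)`: either the point lies more than `M` standard
deviations out and its tail is negligible, or the gain in mean outweighs the loss in variance.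
Conditions 2 and 3 supply this inequality (`mul_sub_varOn_le`, `IsSelected.mul_varOn_sub_le`),
because the sums under their square roots are lower bounds for the variances. -/

/-! ### Smooth test functions with cubic Taylor remainder -/

/-- `f` is continuous, bounded by `1`, and has second order Taylor expansions with remainder at most
`B |h| ^ 3` around every point. -/
def CubicTaylor (B : ℝ) (f : ℝ → ℝ) : Prop :=
  Continuous f ∧ (∀ x, |f x| ≤ 1) ∧ ∃ f₁ f₂ : ℝ → ℝ,
    ∀ x h, |f (x + h) - f x - f₁ x * h - f₂ x * h ^ 2| ≤ B * |h| ^ 3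

/-- The function is locally constant off `[0, 1]`, so its third derivative vanishes there, and on
the compact interval continuity bounds it. -/
theorem exists_bound_iteratedDeriv_smoothTransition :
    ∃ C, ∀ x, |iteratedDeriv 3 Real.smoothTransition x| ≤ C := by
  have hc : Continuous (iteratedDeriv 3 Real.smoothTransition) :=
    (Real.smoothTransition.contDiff (n := 3)).continuous_iteratedDeriv 3 (by norm_num)
  obtain ⟨C, hC⟩ := isCompact_Icc.exists_bound_of_continuousOn
    (hc.continuousOn (s := Set.Icc (0 : ℝ) 1))
  have h0 : 0 ≤ C := (norm_nonneg _).trans (hC 0 (by simp))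
  refine ⟨C, fun x => ?_⟩
  by_cases hx : x ∈ Set.Icc (0 : ℝ) 1
  · exact hC x hx
  have key : ∀ c : ℝ, Real.smoothTransition =ᶠ[𝓝 x] (fun _ => c) →
      |iteratedDeriv 3 Real.smoothTransition x| ≤ C := by
    intro c h
    rw [h.iteratedDeriv_eq 3]
    simpa [iteratedDeriv_const] using h0
  rw [Set.mem_Icc, not_and_or, not_le, not_le] at hx
  rcases hx with hx | hx
  · refine key 0 ?_
    filter_upwards [Iio_mem_nhds hx] with y hy
    exact Real.smoothTransition.zero_of_nonpos (le_of_lt hy)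
  · refine key 1 ?_
    filter_upwards [Ioi_mem_nhds hx] with y hy
    exact Real.smoothTransition.one_of_one_le (le_of_lt hy)

theorem exists_cubicTaylor_smoothTransition :
    ∃ B, 0 ≤ B ∧ CubicTaylor B Real.smoothTransition := by
  obtain ⟨C, hC⟩ := exists_bound_iteratedDeriv_smoothTransition
  have h0 : 0 ≤ C := (abs_nonneg _).trans (hC 0)
  refine ⟨C, h0, Real.smoothTransition.continuous, fun x => ?_,
    deriv Real.smoothTransition, fun x => iteratedDeriv 2 Real.smoothTransition x / 2, ?_⟩
  · rw [abs_of_nonneg (Real.smoothTransition.nonneg x)]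
    exact Real.smoothTransition.le_one x
  intro x h
  rcases eq_or_ne h 0 with rfl | hh
  · simp
  have hne : x ≠ x + h := by simpa using hh
  have hu := uniqueDiffOn_uIcc hne
  obtain ⟨y, -, hy⟩ := taylor_mean_remainder_lagrange_iteratedDeriv (n := 2) hne
    ((Real.smoothTransition.contDiff (n := 3)).contDiffOn.of_le (by norm_num))
  have h1 : iteratedDerivWithin 1 Real.smoothTransition (Set.uIcc x (x + h)) x
      = deriv Real.smoothTransition x := by
    rw [iteratedDerivWithin_eq_iteratedDeriv hu
      (Real.smoothTransition.contDiffAt (n := 1)) Set.left_mem_uIcc, iteratedDeriv_one]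
  have h2 : iteratedDerivWithin 2 Real.smoothTransition (Set.uIcc x (x + h)) x
      = iteratedDeriv 2 Real.smoothTransition x := by
    rw [iteratedDerivWithin_eq_iteratedDeriv hu
      (Real.smoothTransition.contDiffAt (n := 2)) Set.left_mem_uIcc]
  rw [taylorWithinEval_succ, taylorWithinEval_succ, taylor_within_zero_eval] at hy
  norm_num [h1, h2] at hy
  have : Real.smoothTransition (x + h) - Real.smoothTransition x
      - deriv Real.smoothTransition x * h - iteratedDeriv 2 Real.smoothTransition x / 2 * h ^ 2
      = iteratedDeriv 3 Real.smoothTransition y * h ^ 3 / 6 := by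
    linarith
  rw [this, abs_div, abs_mul, abs_pow, abs_of_pos (by norm_num : (0 : ℝ) < 6)]
  have := mul_le_mul_of_nonneg_right (hC y) (pow_nonneg (abs_nonneg h) 3)
  have := mul_nonneg h0 (pow_nonneg (abs_nonneg h) 3)
  linarith

theorem CubicTaylor.comp_affine {B : ℝ} {f : ℝ → ℝ} (hf : CubicTaylor B f) {δ : ℝ} (hδ : 0 < δ)
    (c : ℝ) : CubicTaylor (B / δ ^ 3) (fun x => f ((x - c) / δ)) := by
  obtain ⟨hc, hb, f₁, f₂, h⟩ := hf
  refine ⟨by fun_prop, fun x => hb _, fun x => f₁ ((x - c) / δ) / δ,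
    fun x => f₂ ((x - c) / δ) / δ ^ 2, fun x t => ?_⟩
  have := h ((x - c) / δ) (t / δ)
  rw [abs_div, abs_of_pos hδ] at this
  have e : (x + t - c) / δ = (x - c) / δ + t / δ := by ring
  simp only [e]
  convert this using 1
  · congr 1
    ring
  · ring

/-- Integrating out one matched set leaves the constant `B` unchanged; this is what lets the
induction in `CubicTaylor.lindeberg` run without degrading the bound. -/
theorem CubicTaylor.average {B : ℝ} {f : ℝ → ℝ} (hf : CubicTaylor B f) {n : ℕ} {p : Fin n → ℝ}
    (hp : IsProbVec p) (d : Fin n → ℝ) : CubicTaylor B (fun x => ∑ j, p j * f (x + d j)) := by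
  obtain ⟨hc, hb, f₁, f₂, h⟩ := hf
  refine ⟨by fun_prop, fun x => ?_, fun x => ∑ j, p j * f₁ (x + d j),
    fun x => ∑ j, p j * f₂ (x + d j), fun x t => ?_⟩
  · calc |∑ j, p j * f (x + d j)| ≤ ∑ j, |p j * f (x + d j)| := Finset.abs_sum_le_sum_abs _ _
      _ ≤ ∑ j, p j := Finset.sum_le_sum fun j _ => by
          rw [abs_mul, abs_of_nonneg (hp.1 j)]
          exact mul_le_of_le_one_right (hp.1 j) (hb _)
      _ = 1 := hp.2
  · have e : (∑ j, p j * f (x + t + d j)) - (∑ j, p j * f (x + d j)) -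
        (∑ j, p j * f₁ (x + d j)) * t - (∑ j, p j * f₂ (x + d j)) * t ^ 2 =
        ∑ j, p j * (f (x + d j + t) - f (x + d j) - f₁ (x + d j) * t - f₂ (x + d j) * t ^ 2) := by
      rw [Finset.sum_mul, Finset.sum_mul, ← Finset.sum_sub_distrib, ← Finset.sum_sub_distrib,
        ← Finset.sum_sub_distrib]
      refine Finset.sum_congr rfl fun j _ => ?_
      rw [add_right_comm]
      ring
    rw [e]
    calc _ ≤ ∑ j, |p j * (f (x + d j + t) - f (x + d j) - f₁ (x + d j) * t
          - f₂ (x + d j) * t ^ 2)| := Finset.abs_sum_le_sum_abs _ _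
      _ ≤ ∑ j, p j * (B * |t| ^ 3) := Finset.sum_le_sum fun j _ => by
          rw [abs_mul, abs_of_nonneg (hp.1 j)]
          exact mul_le_mul_of_nonneg_left (h _ _) (hp.1 j)
      _ = B * |t| ^ 3 := by rw [← Finset.sum_mul, hp.2, one_mul]

/-! ### Gaussian moments and Lindeberg replacement -/

/-- Third absolute moment of the standard normal distribution. -/
noncomputable def normalThirdMoment : ℝ := ∫ y, |y| ^ 3 ∂gaussianReal 0 1

theorem normalThirdMoment_nonneg : 0 ≤ normalThirdMoment :=
  integral_nonneg fun _ => by positivity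

theorem integrable_pow_gaussianReal (m : ℕ) (v : NNReal) :
    Integrable (fun y : ℝ => y ^ m) (gaussianReal 0 v) := by
  have h := (memLp_id_gaussianReal (μ := 0) (v := v) m).integrable_norm_pow'
  rw [← integrable_norm_iff (by fun_prop)]
  simpa using h

theorem integrable_abs_cube_gaussianReal (v : NNReal) :
    Integrable (fun y : ℝ => |y| ^ 3) (gaussianReal 0 v) := by
  simpa [abs_pow] using (integrable_pow_gaussianReal 3 v).abs

theorem integral_sq_gaussianReal (v : NNReal) : ∫ y, y ^ 2 ∂gaussianReal 0 v = v := by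
  have h := variance_fun_id_gaussianReal (μ := 0) (v := v)
  rw [variance_eq_integral (by fun_prop)] at h
  simpa using h

theorem integral_abs_cube_gaussianReal (v : NNReal) :
    ∫ y, |y| ^ 3 ∂gaussianReal 0 v = √v ^ 3 * normalThirdMoment := by
  have h : gaussianReal 0 v = (gaussianReal 0 1).map (fun x => √(v : ℝ) * x) := by
    rw [gaussianReal_map_const_mul]
    congr 1
    · simp
    · ext
      simp
  rw [h, integral_map (by fun_prop) (by fun_prop), normalThirdMoment, ← integral_const_mul]
  refine integral_congr_ae (Eventually.of_forall fun y => ?_)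
  simp only [abs_mul, abs_of_nonneg (Real.sqrt_nonneg _), mul_pow]

theorem CubicTaylor.integrable {B : ℝ} {f : ℝ → ℝ} (hf : CubicTaylor B f) (x : ℝ)
    (μ : Measure ℝ) [IsFiniteMeasure μ] : Integrable (fun y => f (x + y)) μ :=
  Integrable.of_bound (C := 1) ((hf.1.comp (by fun_prop)).aestronglyMeasurable)
    (Eventually.of_forall fun _ => hf.2.1 _)

/-- One step of Lindeberg's replacement: a centred discrete variable bounded by `r` is replaced by a
normal variable of the same variance. -/
theorem CubicTaylor.replace {B : ℝ} (hB : 0 ≤ B) {f : ℝ → ℝ} (hf : CubicTaylor B f) {n : ℕ}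
    {p d : Fin n → ℝ} (hp : IsProbVec p) {r : ℝ} (hr : 0 ≤ r) (hd : ∀ j, |d j| ≤ r)
    (hmean : ∑ j, p j * d j = 0) (x : ℝ) :
    |∑ j, p j * f (x + d j) -
      ∫ y, f (x + y) ∂gaussianReal 0 (∑ j, p j * d j ^ 2).toNNReal| ≤
      B * (1 + normalThirdMoment) * r * ∑ j, p j * d j ^ 2 := by
  set V := ∑ j, p j * d j ^ 2 with hV
  have hV0 : 0 ≤ V := Finset.sum_nonneg fun j _ => mul_nonneg (hp.1 j) (sq_nonneg _)
  have hVr : V ≤ r ^ 2 := by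
    calc V ≤ ∑ j, p j * r ^ 2 := Finset.sum_le_sum fun j _ =>
          mul_le_mul_of_nonneg_left (sq_le_sq' (neg_le_of_abs_le (hd j)) (le_of_abs_le (hd j)))
            (hp.1 j)
      _ = r ^ 2 := by rw [← Finset.sum_mul, hp.2, one_mul]
  have hint := hf.integrable x (gaussianReal 0 V.toNNReal)
  obtain ⟨hc, hb, f₁, f₂, h⟩ := hf
  -- Centring kills the linear term. Bounding `|d j| ^ 3` by `r * d j ^ 2` keeps a factor `V` in the
  -- error, so that errors add up over the sets.
  have hsum : |∑ j, p j * f (x + d j) - (f x + f₂ x * V)| ≤ B * r * V := by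
    have e : ∑ j, p j * f (x + d j) - (f x + f₂ x * V) =
        ∑ j, p j * (f (x + d j) - f x - f₁ x * d j - f₂ x * d j ^ 2) := by
      have : ∀ j, p j * (f (x + d j) - f x - f₁ x * d j - f₂ x * d j ^ 2) =
          p j * f (x + d j) - p j * f x - f₁ x * (p j * d j) - f₂ x * (p j * d j ^ 2) :=
        fun j => by ring
      simp only [this, Finset.sum_sub_distrib, ← Finset.mul_sum, ← Finset.sum_mul, hp.2, hmean]
      rw [← hV]
      ring
    rw [e]
    calc _ ≤ ∑ j, |p j * (f (x + d j) - f x - f₁ x * d j - f₂ x * d j ^ 2)| :=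
          Finset.abs_sum_le_sum_abs _ _
      _ ≤ ∑ j, B * r * (p j * d j ^ 2) := Finset.sum_le_sum fun j _ => by
          rw [abs_mul, abs_of_nonneg (hp.1 j)]
          calc _ ≤ p j * (B * |d j| ^ 3) := mul_le_mul_of_nonneg_left (h _ _) (hp.1 j)
            _ = (B * (p j * d j ^ 2)) * |d j| := by rw [← sq_abs (d j)]; ring
            _ ≤ (B * (p j * d j ^ 2)) * r := mul_le_mul_of_nonneg_left (hd j)
                (mul_nonneg hB (mul_nonneg (hp.1 j) (sq_nonneg _)))
            _ = _ := by ring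
      _ = B * r * V := by rw [← Finset.mul_sum]
  -- The same expansion for the normal variable; `√V ≤ r` turns its third moment into a multiple of
  -- `r * V`.
  have hgauss : |∫ y, f (x + y) ∂gaussianReal 0 V.toNNReal - (f x + f₂ x * V)| ≤
      B * normalThirdMoment * r * V := by
    have i1 : Integrable (fun y : ℝ => y) (gaussianReal 0 V.toNNReal) := by
      simpa using integrable_pow_gaussianReal 1 V.toNNReal
    have i2 := integrable_pow_gaussianReal 2 V.toNNReal
    have e : ∫ y, f (x + y) ∂gaussianReal 0 V.toNNReal - (f x + f₂ x * V) =
        ∫ y, (f (x + y) - f x - f₁ x * y - f₂ x * y ^ 2) ∂gaussianReal 0 V.toNNReal := by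
      rw [integral_sub (f := fun y => f (x + y) - f x - f₁ x * y) (g := fun y => f₂ x * y ^ 2)
          ((hint.sub (integrable_const _)).sub (i1.const_mul _)) (i2.const_mul _),
        integral_sub (f := fun y => f (x + y) - f x) (g := fun y => f₁ x * y)
          (hint.sub (integrable_const _)) (i1.const_mul _),
        integral_sub hint (integrable_const _), integral_const_mul, integral_const_mul,
        integral_id_gaussianReal, integral_sq_gaussianReal, Real.coe_toNNReal _ hV0]
      simp
      ring
    rw [e]
    calc _ ≤ ∫ y, |f (x + y) - f x - f₁ x * y - f₂ x * y ^ 2| ∂gaussianReal 0 V.toNNReal :=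
          abs_integral_le_integral_abs
      _ ≤ ∫ y, B * |y| ^ 3 ∂gaussianReal 0 V.toNNReal :=
          integral_mono
            (((hint.sub (integrable_const _)).sub (i1.const_mul _)).sub (i2.const_mul _)).abs
            ((integrable_abs_cube_gaussianReal _).const_mul _) (fun y => h x y)
      _ = B * (√V ^ 3 * normalThirdMoment) := by
          rw [integral_const_mul, integral_abs_cube_gaussianReal, Real.coe_toNNReal _ hV0]
      _ = B * normalThirdMoment * √V * V := by
          rw [pow_succ, Real.sq_sqrt hV0]
          ring
      _ ≤ B * normalThirdMoment * r * V := by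
          refine mul_le_mul_of_nonneg_right (mul_le_mul_of_nonneg_left ?_
            (mul_nonneg hB normalThirdMoment_nonneg)) hV0
          exact Real.sqrt_le_iff.2 ⟨hr, hVr⟩
  rw [abs_le] at *
  constructor <;> nlinarith [hsum.1, hsum.2, hgauss.1, hgauss.2]

theorem sum_pi_succ {m : ℕ} {n : Fin (m + 1) → ℕ} (F : (∀ i, Fin (n i)) → ℝ) :
    ∑ a, F a = ∑ a : ∀ i : Fin m, Fin (n i.succ), ∑ j : Fin (n 0), F (Fin.cons j a) := by
  rw [← (Fin.consEquiv (fun i => Fin (n i))).sum_comp, Fintype.sum_prod_type, Finset.sum_comm]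
  rfl

/-- Induction on the number of sets. The induction hypothesis is applied to the remaining sets with
`f` averaged over the first set as test function; then the first set is replaced at each value of
the Gaussian sum. Convolution merges the two normal variables. -/
theorem CubicTaylor.lindeberg {B : ℝ} (hB : 0 ≤ B) {r : ℝ} (hr : 0 ≤ r) {m : ℕ} :
    ∀ {n : Fin m → ℕ} {p d : ∀ i, Fin (n i) → ℝ} (_ : ∀ i, IsProbVec (p i))
      (_ : ∀ i j, |d i j| ≤ r) (_ : ∀ i, ∑ j, p i j * d i j = 0)
      {f : ℝ → ℝ} (_ : CubicTaylor B f) (x : ℝ),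
      |∑ a : ∀ i, Fin (n i), (∏ i, p i (a i)) * f (x + ∑ i, d i (a i)) -
        ∫ y, f (x + y) ∂gaussianReal 0 (∑ i, ∑ j, p i j * d i j ^ 2).toNNReal| ≤
        B * (1 + normalThirdMoment) * r * ∑ i, ∑ j, p i j * d i j ^ 2 := by
  induction m with
  | zero =>
    intro n p d _ _ _ f hf x
    simp
  | succ m ih =>
    intro n p d hp hd hmean f hf x
    set g : ℝ → ℝ := fun x => ∑ j, p 0 j * f (x + d 0 j) with hg_def
    have hg : CubicTaylor B g := hf.average (hp 0) (d 0)
    have h1 := ih (fun i => hp i.succ) (fun i => hd i.succ) (fun i => hmean i.succ) hg x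
    have e1 : ∑ a : ∀ i, Fin (n i), (∏ i, p i (a i)) * f (x + ∑ i, d i (a i)) =
        ∑ a : ∀ i : Fin m, Fin (n i.succ), (∏ i, p i.succ (a i)) *
          g (x + ∑ i, d i.succ (a i)) := by
      rw [sum_pi_succ]
      refine Finset.sum_congr rfl fun a _ => ?_
      rw [hg_def, Finset.mul_sum]
      refine Finset.sum_congr rfl fun j _ => ?_
      rw [Fin.prod_univ_succ, Fin.sum_univ_succ]
      simp only [Fin.cons_zero, Fin.cons_succ]
      rw [show x + (d 0 j + ∑ i, d i.succ (a i)) = x + ∑ i, d i.succ (a i) + d 0 j by ring]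
      ring
    have hnn : ∀ i, 0 ≤ ∑ j, p i j * d i j ^ 2 := fun i =>
      Finset.sum_nonneg fun j _ => mul_nonneg ((hp i).1 j) (sq_nonneg _)
    set V' := ∑ i : Fin m, ∑ j, p i.succ j * d i.succ j ^ 2 with hV'
    set v := ∑ j, p 0 j * d 0 j ^ 2 with hv
    have hV'0 : 0 ≤ V' := Finset.sum_nonneg fun i _ => hnn _
    have e2 : ∑ i, ∑ j, p i j * d i j ^ 2 = V' + v := by
      rw [Fin.sum_univ_succ, add_comm]
    have e3 : ∫ y, f (x + y) ∂gaussianReal 0 (V' + v).toNNReal =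
        ∫ y, ∫ w, f (x + y + w) ∂gaussianReal 0 v.toNNReal ∂gaussianReal 0 V'.toNNReal := by
      rw [Real.toNNReal_add hV'0 (hnn 0)]
      have := gaussianReal_conv_gaussianReal (m₁ := 0) (m₂ := 0) (v₁ := V'.toNNReal)
        (v₂ := v.toNNReal)
      rw [add_zero] at this
      rw [← this, integral_conv (hf.integrable x _)]
      simp only [add_assoc]
    rw [e1, e2, e3]
    have hint : Integrable (fun y => ∫ w, f (x + y + w) ∂gaussianReal 0 v.toNNReal)
        (gaussianReal 0 V'.toNNReal) := by
      refine Integrable.of_bound (C := 1) ?_ (Eventually.of_forall fun y => ?_)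
      · have hc := hf.1
        exact (StronglyMeasurable.integral_prod_right
          (f := fun y w => f (x + y + w)) (Continuous.stronglyMeasurable
            (by fun_prop))).aestronglyMeasurable
      · refine (norm_integral_le_of_norm_le_const (Eventually.of_forall fun w => hf.2.1 _)).trans ?_
        simp
    have h2 : |∫ y, g (x + y) ∂gaussianReal 0 V'.toNNReal -
        ∫ y, ∫ w, f (x + y + w) ∂gaussianReal 0 v.toNNReal ∂gaussianReal 0 V'.toNNReal| ≤
        B * (1 + normalThirdMoment) * r * v := by
      rw [← integral_sub (hg.integrable x _) hint]
      have h3 : ∀ᵐ y ∂gaussianReal 0 V'.toNNReal,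
          ‖g (x + y) - ∫ w, f (x + y + w) ∂gaussianReal 0 v.toNNReal‖ ≤
            B * (1 + normalThirdMoment) * r * v :=
        Eventually.of_forall fun y => hf.replace hB (hp 0) hr (hd 0) (hmean 0) (x + y)
      simpa using norm_integral_le_of_norm_le_const h3
    calc _ ≤ _ := abs_sub_le _ (∫ y, g (x + y) ∂gaussianReal 0 V'.toNNReal) _
      _ ≤ _ := add_le_add h1 h2
      _ = _ := by ring

/-! ### One matched set: means, variances and sensitivity models -/

section SetLevel

variable {n : ℕ} {p c : Fin n → ℝ}

theorem IsProbVec.pos (hp : IsProbVec p) : 0 < n := by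
  rcases Nat.eq_zero_or_pos n with rfl | h
  · exact absurd hp.2 (by simp)
  · exact h

theorem IsProbVec.sum_mul_sub_setMean (hp : IsProbVec p) (c : Fin n → ℝ) :
    ∑ j, p j * (c j - setMean p c) = 0 := by
  simp only [mul_sub, Finset.sum_sub_distrib, ← Finset.sum_mul, hp.2, one_mul]
  exact sub_self _

theorem le_iSup_fin (c : Fin n → ℝ) (j : Fin n) : c j ≤ ⨆ j, c j :=
  le_ciSup (Set.finite_range c).bddAbove j

theorem iInf_fin_le (c : Fin n → ℝ) (j : Fin n) : ⨅ j, c j ≤ c j :=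
  ciInf_le (Set.finite_range c).bddBelow j

theorem IsProbVec.setMean_le (hp : IsProbVec p) {M : ℝ} (h : ∀ j, c j ≤ M) : setMean p c ≤ M := by
  calc setMean p c ≤ ∑ j, p j * M :=
        Finset.sum_le_sum fun j _ => mul_le_mul_of_nonneg_left (h j) (hp.1 j)
    _ = M := by rw [← Finset.sum_mul, hp.2, one_mul]

theorem IsProbVec.le_setMean (hp : IsProbVec p) {M : ℝ} (h : ∀ j, M ≤ c j) : M ≤ setMean p c := by
  calc M = ∑ j, p j * M := by rw [← Finset.sum_mul, hp.2, one_mul]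
    _ ≤ setMean p c :=
        Finset.sum_le_sum fun j _ => mul_le_mul_of_nonneg_left (h j) (hp.1 j)

theorem IsProbVec.abs_sub_setMean_le (hp : IsProbVec p) (c : Fin n → ℝ) (j : Fin n) :
    |c j - setMean p c| ≤ setRange c := by
  have h1 := hp.setMean_le (le_iSup_fin c)
  have h2 := hp.le_setMean (iInf_fin_le c)
  have h3 := le_iSup_fin c j
  have h4 := iInf_fin_le c j
  rw [setRange, abs_le]
  constructor <;> linarith

theorem IsProbVec.setVar_nonneg (hp : IsProbVec p) (c : Fin n → ℝ) : 0 ≤ setVar p c :=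
  Finset.sum_nonneg fun j _ => mul_nonneg (hp.1 j) (sq_nonneg _)

theorem IsProbVec.setVar_le (hp : IsProbVec p) (c : Fin n → ℝ) : setVar p c ≤ setRange c ^ 2 := by
  calc setVar p c ≤ ∑ j, p j * setRange c ^ 2 :=
        Finset.sum_le_sum fun j _ => mul_le_mul_of_nonneg_left
          (sq_le_sq' (neg_le_of_abs_le (hp.abs_sub_setMean_le c j))
            (le_of_abs_le (hp.abs_sub_setMean_le c j))) (hp.1 j)
    _ = _ := by rw [← Finset.sum_mul, hp.2, one_mul]

/-- Only the two units attaining the maximum and minimum of `c` are kept; for them `2 * (x ^ 2 + y ^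
2) ≥ (x - y) ^ 2`. -/
theorem IsProbVec.le_setVar (hp : IsProbVec p) (c : Fin n → ℝ) {m : ℝ} (hm : 0 ≤ m)
    (h : ∀ j, m ≤ p j) : m / 2 * setRange c ^ 2 ≤ setVar p c := by
  have : Nonempty (Fin n) := ⟨⟨0, hp.pos⟩⟩
  obtain ⟨a, ha⟩ := exists_eq_ciSup_of_finite (f := c)
  obtain ⟨b, hb⟩ := exists_eq_ciInf_of_finite (f := c)
  rw [setRange, ← ha, ← hb]
  rcases eq_or_ne a b with rfl | hab
  · simpa using hp.setVar_nonneg c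
  set μ := setMean p c with hμ
  have h1 : ∑ j ∈ {a, b}, p j * (c j - μ) ^ 2 ≤ setVar p c :=
    Finset.sum_le_sum_of_subset_of_nonneg (Finset.subset_univ _)
      fun j _ _ => mul_nonneg (hp.1 j) (sq_nonneg _)
  rw [Finset.sum_pair hab] at h1
  have h2 := mul_le_mul_of_nonneg_right (h a) (sq_nonneg (c a - μ))
  have h3 := mul_le_mul_of_nonneg_right (h b) (sq_nonneg (c b - μ))
  have h4 := mul_nonneg hm (sq_nonneg (c a - μ + (c b - μ)))
  nlinarith

/-- A probability vector bounded below by `1 / (n Γ)` has variance at least `R² / (n Γ)³`. -/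
theorem IsProbVec.setRange_sq_div_le (hp : IsProbVec p) (c : Fin n → ℝ) (hn : 2 ≤ n) {Γ : ℝ}
    (hΓ : 1 ≤ Γ) (h : ∀ j, ((n : ℝ) * Γ)⁻¹ ≤ p j) :
    setRange c ^ 2 / ((n : ℝ) * Γ) ^ 3 ≤ setVar p c := by
  have hn' : (2 : ℝ) ≤ n := by exact_mod_cast hn
  have hx : 2 ≤ (n : ℝ) * Γ := by nlinarith
  set x := (n : ℝ) * Γ
  have hx0 : 0 < x := by linarith
  refine le_trans ?_ (hp.le_setVar c (inv_nonneg.2 hx0.le) h)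
  rw [div_eq_mul_inv, mul_comm]
  refine mul_le_mul_of_nonneg_right ?_ (sq_nonneg _)
  -- It remains to see `2 * x ≤ x ^ 3`, which holds since `x ≥ 2`.
  rw [inv_eq_one_div, inv_eq_one_div, div_div]
  refine one_div_le_one_div_of_le (by positivity) ?_
  nlinarith [mul_nonneg hx0.le (sub_nonneg.2 hx)]

theorem IsProbVec.inv_le_iSup (hp : IsProbVec p) : (n : ℝ)⁻¹ ≤ ⨆ j, p j := by
  have hn : (0 : ℝ) < n := by exact_mod_cast hp.pos
  rw [inv_le_iff_one_le_mul₀ hn, ← hp.2]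
  calc ∑ j, p j ≤ ∑ _j : Fin n, ⨆ j, p j := Finset.sum_le_sum fun j _ => le_iSup_fin p j
    _ = _ := by simp [mul_comm]

theorem IsProbVec.iInf_nonneg (hp : IsProbVec p) : 0 ≤ ⨅ j, p j :=
  Real.iInf_nonneg hp.1

theorem IsProbVec.iSup_pos (hp : IsProbVec p) : 0 < ⨆ j, p j :=
  lt_of_lt_of_le (by have := hp.pos; positivity) hp.inv_le_iSup

theorem IsProbVec.iInf_pos (hp : IsProbVec p) (h : hiddenBias p ≠ ⊤) : 0 < ⨅ j, p j := by
  refine lt_of_le_of_ne hp.iInf_nonneg fun h0 => h ?_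
  rw [hiddenBias, ← h0, ENNReal.ofReal_zero]
  exact ENNReal.div_zero (by simpa using hp.iSup_pos)

theorem IsProbVec.toReal_hiddenBias (hp : IsProbVec p) :
    (hiddenBias p).toReal = (⨆ j, p j) / ⨅ j, p j := by
  rw [hiddenBias, ENNReal.toReal_div, ENNReal.toReal_ofReal hp.iSup_pos.le,
    ENNReal.toReal_ofReal hp.iInf_nonneg]

theorem IsProbVec.one_le_toReal_hiddenBias (hp : IsProbVec p) (h : hiddenBias p ≠ ⊤) :
    1 ≤ (hiddenBias p).toReal := by
  rw [hp.toReal_hiddenBias, one_le_div (hp.iInf_pos h)]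
  exact (iInf_fin_le p ⟨0, hp.pos⟩).trans (le_iSup_fin p _)

/-- The largest probability is at least `1 / n`, and the smallest is the largest divided by the
bias. -/
theorem IsProbVec.inv_mul_hiddenBias_le (hp : IsProbVec p) (h : hiddenBias p ≠ ⊤) (j : Fin n) :
    ((n : ℝ) * (hiddenBias p).toReal)⁻¹ ≤ p j := by
  have hn : (0 : ℝ) < n := by exact_mod_cast hp.pos
  have h0 := hp.iInf_pos h
  refine le_trans ?_ (iInf_fin_le p j)
  have hs := hp.iSup_pos
  rw [hp.toReal_hiddenBias, mul_inv, inv_div, mul_div_assoc', div_le_iff₀ hs, mul_comm]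
  exact mul_le_mul_of_nonneg_left hp.inv_le_iSup h0.le

theorem IsProbVec.info_le_setVar (hp : IsProbVec p) (c : Fin n → ℝ) (hn : 2 ≤ n) :
    setRange c ^ 2 * ((((n : ℝ≥0∞) * hiddenBias p) ^ 3)⁻¹).toReal ≤ setVar p c := by
  by_cases h : hiddenBias p = ⊤
  · have : (n : ℝ≥0∞) ≠ 0 := by
      have := hp.pos
      positivity
    rw [h, ENNReal.mul_top this]
    simpa using hp.setVar_nonneg c
  · have := hp.setRange_sq_div_le c hn (hp.one_le_toReal_hiddenBias h) (hp.inv_mul_hiddenBias_le h)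
    simpa [div_eq_mul_inv] using this

theorem isProbVec_sensProb (hn : 0 < n) (Γ : ℝ) (u : Fin n → ℝ) : IsProbVec (sensProb Γ u) := by
  have : Nonempty (Fin n) := ⟨⟨0, hn⟩⟩
  have h : 0 < ∑ l, Real.exp (Real.log Γ * u l) :=
    Finset.sum_pos (fun _ _ => Real.exp_pos _) Finset.univ_nonempty
  refine ⟨fun j => div_nonneg (Real.exp_pos _).le h.le, ?_⟩
  simp only [sensProb, ← Finset.sum_div]
  exact div_self h.ne'

theorem inv_le_sensProb (hn : 0 < n) {Γ : ℝ} (hΓ : 1 ≤ Γ) {u : Fin n → ℝ}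
    (hu : ∀ j, u j ∈ Set.Icc (0 : ℝ) 1) (j : Fin n) : ((n : ℝ) * Γ)⁻¹ ≤ sensProb Γ u j := by
  have : Nonempty (Fin n) := ⟨⟨0, hn⟩⟩
  have h : 0 < ∑ l, Real.exp (Real.log Γ * u l) :=
    Finset.sum_pos (fun _ _ => Real.exp_pos _) Finset.univ_nonempty
  have hlog := Real.log_nonneg hΓ
  have h2 : ∑ l, Real.exp (Real.log Γ * u l) ≤ n * Γ := by
    calc _ ≤ ∑ _l : Fin n, Γ := Finset.sum_le_sum fun l _ => by
          rw [← Real.le_log_iff_exp_le (by linarith)]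
          exact mul_le_of_le_one_right hlog (hu l).2
      _ = n * Γ := by simp
  have h1 : 1 ≤ Real.exp (Real.log Γ * u j) := Real.one_le_exp (mul_nonneg hlog (hu j).1)
  rw [sensProb, inv_eq_one_div]
  gcongr

theorem IsProbVec.of_mem_sensModels (hn : 0 < n) {Γ : ℝ≥0∞} (h : p ∈ SensModels n Γ) :
    IsProbVec p := by
  rcases h with ⟨-, h⟩ | ⟨-, u, -, rfl⟩
  · exact h
  · exact isProbVec_sensProb hn _ _

theorem mem_sensModels_top : p ∈ SensModels n ⊤ ↔ IsProbVec p := by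
  simp [SensModels]

theorem mem_sensModels_ofReal {Γ : ℝ} (hΓ : 1 ≤ Γ) : p ∈ SensModels n (ENNReal.ofReal Γ) ↔
    ∃ u : Fin n → ℝ, (∀ j, u j ∈ Set.Icc (0 : ℝ) 1) ∧ p = sensProb Γ u := by
  simp [SensModels, ENNReal.toReal_ofReal (zero_le_one.trans hΓ)]

theorem IsProbVec.mem_sensModels (hp : IsProbVec p) {Γ : ℝ} (hΓ : 1 ≤ Γ)
    (h : hiddenBias p ≤ ENNReal.ofReal Γ) : p ∈ SensModels n (ENNReal.ofReal Γ) := by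
  have htop : hiddenBias p ≠ ⊤ := (h.trans_lt ENNReal.ofReal_lt_top).ne
  have h0 := hp.iInf_pos htop
  have h1 : (⨆ j, p j) / ⨅ j, p j ≤ Γ := by
    rw [← hp.toReal_hiddenBias]
    exact ENNReal.toReal_le_of_le_ofReal (by linarith) h
  set m := ⨅ j, p j with hm
  have hlo : ∀ j, 1 ≤ p j / m := fun j => (one_le_div h0).2 (iInf_fin_le p j)
  have hhi : ∀ j, p j / m ≤ Γ := fun j =>
    le_trans (div_le_div_of_nonneg_right (le_iSup_fin p j) h0.le) h1
  have hlog := Real.log_nonneg hΓ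
  have hle : ∀ j, Real.log (p j / m) ≤ Real.log Γ := fun j =>
    Real.log_le_log (by linarith [hlo j]) (hhi j)
  rw [mem_sensModels_ofReal hΓ]
  -- This `u` solves `Γ ^ u j = p j / m`. For `Γ = 1` the division by zero gives `u = 0`, which is
  -- correct because then all `p j = m`.
  refine ⟨fun j => Real.log (p j / m) / Real.log Γ, fun j =>
    ⟨div_nonneg (Real.log_nonneg (hlo j)) hlog, div_le_one_of_le₀ (hle j) hlog⟩, ?_⟩
  have he : ∀ j, Real.exp (Real.log Γ * (Real.log (p j / m) / Real.log Γ)) = p j / m := by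
    intro j
    rw [mul_div_cancel_of_imp', Real.exp_log (by linarith [hlo j])]
    intro hz
    exact le_antisymm (hz ▸ hle j) (Real.log_nonneg (hlo j))
  funext j
  simp only [sensProb, he, ← Finset.sum_div, hp.2]
  field_simp

theorem bddAbove_setMean (hn : 0 < n) (c : Fin n → ℝ) (Γ : ℝ≥0∞) :
    BddAbove {m | ∃ p ∈ SensModels n Γ, m = setMean p c} := by
  refine ⟨⨆ j, c j, ?_⟩
  rintro _ ⟨p, hp, rfl⟩
  exact (IsProbVec.of_mem_sensModels hn hp).setMean_le (le_iSup_fin c)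

theorem setMean_le_maxMean (hn : 0 < n) (c : Fin n → ℝ) {Γ : ℝ≥0∞} (hp : p ∈ SensModels n Γ) :
    setMean p c ≤ maxMean c Γ :=
  le_csSup (bddAbove_setMean hn c Γ) ⟨p, hp, rfl⟩

theorem setVar_le_maxVar (hn : 0 < n) (c : Fin n → ℝ) {Γ : ℝ≥0∞} (hp : p ∈ SensModels n Γ)
    (h : setMean p c = maxMean c Γ) : setVar p c ≤ maxVar c Γ := by
  refine le_csSup ⟨setRange c ^ 2, ?_⟩ ⟨p, hp, h, rfl⟩
  rintro _ ⟨p, hp, -, rfl⟩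
  exact (IsProbVec.of_mem_sensModels hn hp).setVar_le c

/-- The mean is continuous in `u` on the compact cube. Attainment matters: otherwise `maxVar` would
be the supremum of an empty set, and no lower bound for it would be available. -/
theorem exists_setMean_eq_maxMean (hn : 0 < n) (c : Fin n → ℝ) {Γ : ℝ} (hΓ : 1 ≤ Γ) :
    ∃ p ∈ SensModels n (ENNReal.ofReal Γ), setMean p c = maxMean c (ENNReal.ofReal Γ) := by
  have : Nonempty (Fin n) := ⟨⟨0, hn⟩⟩
  have hcont : Continuous fun u : Fin n → ℝ => setMean (sensProb Γ u) c := by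
    unfold setMean sensProb
    refine continuous_finsetSum _ fun j _ => Continuous.mul (Continuous.div (by fun_prop)
      (by fun_prop) fun u => ?_) continuous_const
    exact (Finset.sum_pos (fun _ _ => Real.exp_pos _) Finset.univ_nonempty).ne'
  obtain ⟨u, hu, hmax⟩ := (isCompact_univ_pi fun _ : Fin n => isCompact_Icc (a := (0 : ℝ))
    (b := 1)).exists_isMaxOn
    ⟨0, fun j _ => by simp⟩ hcont.continuousOn
  have hmem : sensProb Γ u ∈ SensModels n (ENNReal.ofReal Γ) :=
    (mem_sensModels_ofReal hΓ).2 ⟨u, fun j => hu j trivial, rfl⟩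
  refine ⟨_, hmem, le_antisymm (setMean_le_maxMean hn c hmem) ?_⟩
  refine csSup_le ⟨_, _, hmem, rfl⟩ ?_
  rintro _ ⟨p, hp, rfl⟩
  obtain ⟨w, hw, rfl⟩ := (mem_sensModels_ofReal hΓ).1 hp
  exact hmax (fun j _ => hw j)

theorem setRange_sq_div_le_maxVar (hn : 2 ≤ n) (c : Fin n → ℝ) {Γ : ℝ} (hΓ : 1 ≤ Γ) :
    setRange c ^ 2 / ((n : ℝ) * Γ) ^ 3 ≤ maxVar c (ENNReal.ofReal Γ) := by
  have hn0 : 0 < n := by omega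
  obtain ⟨p, hp, h⟩ := exists_setMean_eq_maxMean hn0 c hΓ
  refine le_trans ?_ (setVar_le_maxVar hn0 c hp h)
  obtain ⟨u, hu, rfl⟩ := (mem_sensModels_ofReal hΓ).1 hp
  exact (isProbVec_sensProb hn0 _ _).setRange_sq_div_le c hn hΓ (inv_le_sensProb hn0 hΓ hu)

theorem maxVar_nonneg (hn : 0 < n) (c : Fin n → ℝ) (Γ : ℝ≥0∞) : 0 ≤ maxVar c Γ := by
  refine Real.sSup_nonneg ?_
  rintro _ ⟨p, hp, -, rfl⟩
  exact (IsProbVec.of_mem_sensModels hn hp).setVar_nonneg c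

theorem isProbVec_single (j : Fin n) : IsProbVec (Pi.single j (1 : ℝ)) := by
  refine ⟨fun i => ?_, by simp⟩
  rcases eq_or_ne i j with rfl | h
  · simp
  · simp [h]

theorem le_maxMean_top (c : Fin n → ℝ) (j : Fin n) : c j ≤ maxMean c ⊤ := by
  have h := setMean_le_maxMean (Fin.pos j) c (mem_sensModels_top.2 (isProbVec_single j))
  simpa [setMean, Pi.single_apply] using h

/-- A model maximizing the unrestricted mean is supported where `c` is maximal, so the statistic is
almost surely constant. -/
theorem maxVar_top (hn : 0 < n) (c : Fin n → ℝ) : maxVar c ⊤ = 0 := by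
  refine le_antisymm (Real.sSup_nonpos ?_) (maxVar_nonneg hn c ⊤)
  rintro _ ⟨p, hp, hM, rfl⟩
  have hpv := mem_sensModels_top.1 hp
  have h0 := hpv.sum_mul_sub_setMean c
  refine le_of_eq (Finset.sum_eq_zero fun j _ => ?_)
  have hz : p j * (c j - setMean p c) = 0 :=
    (Finset.sum_eq_zero_iff_of_nonpos fun j _ => mul_nonpos_of_nonneg_of_nonpos (hpv.1 j)
      (sub_nonpos.2 (hM ▸ le_maxMean_top c j))).1 h0 j (Finset.mem_univ j)
  rw [sq, ← mul_assoc, hz, zero_mul]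

end SetLevel

/-! ### Normal tails and a uniform central limit theorem -/

/-- Upper tail of the standard normal distribution. -/
noncomputable def normalTail (x : ℝ) : ℝ := (gaussianReal 0 1).real (Set.Ici x)

theorem normalTail_nonneg (x : ℝ) : 0 ≤ normalTail x := measureReal_nonneg

theorem normalTail_antitone : Antitone normalTail := fun _ _ h =>
  measureReal_mono (Set.Ici_subset_Ici.2 h)

theorem sq_mul_normalTail_le {x : ℝ} (hx : 0 ≤ x) : x ^ 2 * normalTail x ≤ 1 := by
  have h := mul_meas_ge_le_integral_of_nonneg (μ := gaussianReal 0 1) (f := fun y : ℝ => y ^ 2)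
    (Eventually.of_forall fun y => sq_nonneg y) (integrable_pow_gaussianReal 2 1) (x ^ 2)
  rw [integral_sq_gaussianReal] at h
  refine le_trans (mul_le_mul_of_nonneg_left (measureReal_mono ?_) (sq_nonneg x)) h
  intro y hy
  exact pow_le_pow_left₀ hx hy 2

theorem exists_normalTail_le {ε : ℝ} (hε : 0 < ε) : ∃ M, 0 < M ∧ normalTail M ≤ ε := by
  refine ⟨1 + ε⁻¹, by positivity, ?_⟩
  have h := sq_mul_normalTail_le (x := 1 + ε⁻¹) (by positivity)
  have h0 := normalTail_nonneg (1 + ε⁻¹)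
  have h1 : ε⁻¹ * normalTail (1 + ε⁻¹) ≤ 1 := by
    refine le_trans (mul_le_mul_of_nonneg_right ?_ h0) h
    nlinarith [inv_pos.2 hε]
  rwa [inv_mul_le_iff₀ hε, mul_one] at h1

/-- The standard normal density is at most `1`. -/
theorem normalTail_sub_le (x : ℝ) {δ : ℝ} (hδ : 0 ≤ δ) :
    normalTail (x - δ) ≤ normalTail x + δ := by
  have hs : Set.Ici (x - δ) = Set.Ici x ∪ Set.Ico (x - δ) x := by
    rw [Set.union_comm, Set.Ico_union_Ici_eq_Ici (by linarith)]
  have hI : (gaussianReal 0 1).real (Set.Ico (x - δ) x) ≤ δ := by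
    rw [measureReal_def, gaussianReal_apply_eq_integral 0 one_ne_zero]
    rw [ENNReal.toReal_ofReal (integral_nonneg fun y => gaussianPDFReal_nonneg 0 1 y)]
    have hpdf : ∀ y, gaussianPDFReal 0 1 y ≤ 1 := by
      intro y
      rw [gaussianPDFReal]
      refine mul_le_one₀ (inv_le_one_of_one_le₀ ?_) (Real.exp_pos _).le (Real.exp_le_one_iff.2 ?_)
      · rw [Real.one_le_sqrt]
        simp only [NNReal.coe_one, mul_one]
        linarith [Real.pi_gt_three]
      · have := sq_nonneg (y - 0)
        simp only [NNReal.coe_one, mul_one, neg_div]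
        linarith
    calc _ ≤ ∫ _y in Set.Ico (x - δ) x, (1 : ℝ) :=
          setIntegral_mono (integrable_gaussianPDFReal 0 1).integrableOn (by simp) hpdf
      _ = δ := by simp [hδ]
  rw [normalTail, hs]
  exact (measureReal_union_le _ _).trans (add_le_add le_rfl hI)

/-- Upper tail at `c` of the normal distribution with mean `m` and variance `v`; it is taken to
be `0` for a degenerate distribution. -/
noncomputable def normalTailAt (m v c : ℝ) : ℝ :=
  if v ≤ 0 then 0 else normalTail ((c - m) / √v)

theorem normalTailAt_nonneg (m v c : ℝ) : 0 ≤ normalTailAt m v c := by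
  unfold normalTailAt
  split_ifs
  · exact le_rfl
  · exact normalTail_nonneg _

/-- Only an inequality: for `v ≤ 0` the right side is the tail of a point mass, which may be `1`. -/
theorem normalTailAt_le_gaussianReal (m v c : ℝ) :
    normalTailAt m v c ≤ (gaussianReal m v.toNNReal).real (Set.Ici c) := by
  unfold normalTailAt
  split_ifs with h
  · exact measureReal_nonneg
  push Not at h
  have hs := Real.sqrt_pos.2 h
  have e : gaussianReal m v.toNNReal = (gaussianReal 0 1).map (fun x => √v * x + m) := by
    have : (fun x => √v * x + m) = (fun x => x + m) ∘ (fun x => √v * x) := rfl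
    rw [this, ← Measure.map_map (by fun_prop) (by fun_prop), gaussianReal_map_const_mul,
      gaussianReal_map_add_const]
    congr 1
    · simp
    · ext
      simp [Real.coe_toNNReal _ h.le, Real.sq_sqrt h.le]
  rw [e, map_measureReal_apply (by fun_prop) measurableSet_Ici, normalTail]
  refine le_of_eq (congrArg _ ?_)
  ext x
  simp only [Set.mem_Ici, Set.mem_preimage]
  rw [div_le_iff₀ hs, sub_le_iff_le_add, mul_comm]

theorem normalTailAt_mono_var {m v₁ v₂ c : ℝ} (hm : m ≤ c) (hv : v₁ ≤ v₂) :
    normalTailAt m v₁ c ≤ normalTailAt m v₂ c := by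
  by_cases h1 : v₁ ≤ 0
  · rw [normalTailAt, if_pos h1]
    exact normalTailAt_nonneg _ _ _
  · have h2 : ¬ v₂ ≤ 0 := by linarith
    rw [normalTailAt, normalTailAt, if_neg h1, if_neg h2]
    push Not at h1
    refine normalTail_antitone ?_
    have := Real.sqrt_pos.2 h1
    have := Real.sqrt_le_sqrt hv
    exact div_le_div_of_nonneg_left (by linarith) (by assumption) this

theorem normalTailAt_mono_mean {m₁ m₂ v c : ℝ} (hm : m₁ ≤ m₂) :
    normalTailAt m₁ v c ≤ normalTailAt m₂ v c := by
  unfold normalTailAt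
  split_ifs with h
  · exact le_rfl
  · refine normalTail_antitone (div_le_div_of_nonneg_right (by linarith) (Real.sqrt_nonneg _))

/-- A larger mean compensates for a smaller variance. -/
theorem normalTailAt_compare {m₁ m₂ v₁ v₂ c M : ℝ} (hm : m₁ ≤ m₂) (hc : m₂ ≤ c) (hM : 0 ≤ M)
    (hv₂ : 0 ≤ v₂) (h : v₂ < v₁ → M * (v₁ - v₂) ≤ √v₁ * (m₂ - m₁)) :
    normalTailAt m₁ v₁ c ≤ normalTailAt m₂ v₂ c + normalTail M := by
  rcases le_or_gt v₁ v₂ with hv | hv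
  · have := normalTail_nonneg M
    have := (normalTailAt_mono_mean hm).trans (normalTailAt_mono_var hc hv)
    linarith
  have h1 : 0 < v₁ := by linarith
  have hh := h hv
  set s := √v₁ with hs
  set t := √v₂ with ht
  have hs0 : 0 < s := Real.sqrt_pos.2 h1
  have ht0 : 0 ≤ t := Real.sqrt_nonneg _
  have hs2 : s ^ 2 = v₁ := Real.sq_sqrt h1.le
  have ht2 : t ^ 2 = v₂ := Real.sq_sqrt hv₂
  rw [← hs2, ← ht2] at hh
  have hts : t < s := Real.sqrt_lt_sqrt hv₂ hv
  rw [normalTailAt, if_neg (by linarith), ← hs]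
  have hn2 := normalTailAt_nonneg m₂ v₂ c
  have hn3 := normalTail_nonneg M
  -- Far out, the left tail is already below `normalTail M`; otherwise `c - m₁ < M * s`.
  by_cases hbig : M ≤ (c - m₁) / s
  · have := normalTail_antitone hbig
    linarith
  push Not at hbig
  rw [div_lt_iff₀ hs0] at hbig
  -- If `t = 0`, the hypothesis gives `m₂ - m₁ ≥ M * s`, so `c` would lie beyond `M` standard
  -- deviations.
  have ht_pos : 0 < t := by
    refine lt_of_le_of_ne ht0 fun h0 => ?_
    rw [← h0] at hh
    have : M * s ≤ m₂ - m₁ := by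
      have : s * (M * s) ≤ s * (m₂ - m₁) := by nlinarith
      exact le_of_mul_le_mul_left this hs0
    nlinarith [mul_nonneg hM hs0.le]
  have hv2 : 0 < v₂ := by rw [← ht2]; positivity
  rw [normalTailAt, if_neg (by linarith), ← ht]
  refine le_trans (normalTail_antitone ?_) (le_add_of_nonneg_right hn3)
  rw [div_le_div_iff₀ ht_pos hs0]
  -- Multiplied by `s - t`, this gives `(c - m₁) * (s - t) ≤ M * (s ^ 2 - t ^ 2) ≤ s * (m₂ - m₁)`, a
  -- rearrangement of the goal.
  have h3 : c - m₁ ≤ M * (s + t) := by nlinarith [mul_nonneg hM ht0]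
  nlinarith [mul_le_mul_of_nonneg_left h3 (sub_nonneg.2 hts.le)]

/-- Uniform one-sided central limit theorem for sums of independent discrete variables. -/
theorem exists_tail_le_normalTailAt {ε : ℝ} (hε : 0 < ε) : ∃ η : ℝ, 0 < η ∧
    ∀ {m : ℕ} {n : Fin m → ℕ} {p c : ∀ i, Fin (n i) → ℝ} (_ : ∀ i, IsProbVec (p i))
      (_ : 0 < ∑ i, setVar (p i) (c i))
      (_ : ∀ i, setRange (c i) ^ 2 ≤ η * ∑ i, setVar (p i) (c i)) (t : ℝ),
      ∑ a : ∀ i, Fin (n i), {a : ∀ i, Fin (n i) | t ≤ ∑ i, c i (a i)}.indicator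
        (fun a => ∏ i, p i (a i)) a ≤
        normalTailAt (∑ i, setMean (p i) (c i)) (∑ i, setVar (p i) (c i)) t + ε := by
  obtain ⟨B, hB, hψ⟩ := exists_cubicTaylor_smoothTransition
  -- Half of `ε` pays for smoothing the indicator over an interval of width `δ`, half for the
  -- replacement error `C * r`. The `+ 1` in `r` avoids dividing by zero.
  set δ := ε / 2 with hδ_def
  have hδ : 0 < δ := by positivity
  set C := B / δ ^ 3 * (1 + normalThirdMoment) with hC_def
  have hC : 0 ≤ C := mul_nonneg (by positivity) (by linarith [normalThirdMoment_nonneg])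
  set r := δ / (C + 1) with hr_def
  have hr : 0 < r := by positivity
  refine ⟨r ^ 2, by positivity, ?_⟩
  intro m n p c hp hV hR t
  set V := ∑ i, setVar (p i) (c i) with hV_def
  set s := √V with hs_def
  have hs : 0 < s := Real.sqrt_pos.2 hV
  have hs2 : s ^ 2 = V := Real.sq_sqrt hV.le
  set μ := ∑ i, setMean (p i) (c i) with hμ
  set τ := (t - μ) / s with hτ
  set d : ∀ i, Fin (n i) → ℝ := fun i j => (c i j - setMean (p i) (c i)) / s with hd_def
  set f : ℝ → ℝ := fun x => Real.smoothTransition ((x - (τ - δ)) / δ) with hf_def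
  have hf : CubicTaylor (B / δ ^ 3) f := hψ.comp_affine hδ (τ - δ)
  have hd : ∀ i j, |d i j| ≤ r := by
    intro i j
    rw [hd_def, abs_div, abs_of_pos hs, div_le_iff₀ hs]
    refine ((hp i).abs_sub_setMean_le (c i) j).trans ?_
    refine abs_le_of_sq_le_sq' ?_ (by positivity) |>.2
    rw [mul_pow, hs2]
    exact hR i
  have hmean : ∀ i, ∑ j, p i j * d i j = 0 := by
    intro i
    simp only [hd_def, mul_div_assoc', ← Finset.sum_div, (hp i).sum_mul_sub_setMean (c i), zero_div]
  have hvar : ∑ i, ∑ j, p i j * d i j ^ 2 = 1 := by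
    simp only [hd_def, div_pow, mul_div_assoc', ← Finset.sum_div]
    rw [hs2]
    exact div_self hV.ne'
  have key := hf.lindeberg (by positivity) hr.le hp hd hmean 0
  rw [hvar, Real.toNNReal_one, mul_one] at key
  simp only [zero_add] at key
  have hCr : C * r ≤ δ := by
    rw [hr_def, mul_div_assoc', div_le_iff₀ (by positivity)]
    nlinarith
  have h1 : ∑ a : ∀ i, Fin (n i), {a : ∀ i, Fin (n i) | t ≤ ∑ i, c i (a i)}.indicator
        (fun a => ∏ i, p i (a i)) a ≤
      ∑ a : ∀ i, Fin (n i), (∏ i, p i (a i)) * f (∑ i, d i (a i)) := by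
    refine Finset.sum_le_sum fun a _ => ?_
    have hprod : 0 ≤ ∏ i, p i (a i) := Finset.prod_nonneg fun i _ => (hp i).1 _
    by_cases ha : t ≤ ∑ i, c i (a i)
    · rw [Set.indicator_of_mem (show a ∈ {a : ∀ i, Fin (n i) | t ≤ ∑ i, c i (a i)} from ha)]
      refine le_of_eq ?_
      rw [hf_def]
      simp only
      rw [Real.smoothTransition.one_of_one_le, mul_one]
      rw [le_div_iff₀ hδ, one_mul]
      have : ∑ i, d i (a i) = (∑ i, c i (a i) - μ) / s := by
        rw [hd_def, hμ, ← Finset.sum_sub_distrib, Finset.sum_div]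
      rw [this, hτ]
      have : (t - μ) / s ≤ (∑ i, c i (a i) - μ) / s :=
        div_le_div_of_nonneg_right (by linarith) hs.le
      linarith
    · rw [Set.indicator_of_notMem (show a ∉ {a : ∀ i, Fin (n i) | t ≤ ∑ i, c i (a i)} from ha)]
      exact mul_nonneg hprod (Real.smoothTransition.nonneg _)
  have h2 : ∫ y, f y ∂gaussianReal 0 1 ≤ normalTail (τ - δ) := by
    rw [normalTail, ← integral_indicator_one measurableSet_Ici]
    refine integral_mono (by simpa using hf.integrable 0 (gaussianReal 0 1))
      ((integrable_const (1 : ℝ)).indicator measurableSet_Ici) fun y => ?_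
    by_cases hy : τ - δ ≤ y
    · rw [Set.indicator_of_mem (show y ∈ Set.Ici (τ - δ) from hy)]
      exact Real.smoothTransition.le_one _
    · rw [Set.indicator_of_notMem (show y ∉ Set.Ici (τ - δ) from hy)]
      push Not at hy
      exact (Real.smoothTransition.zero_of_nonpos
        (div_nonpos_of_nonpos_of_nonneg (by linarith) hδ.le)).le
  have h3 := normalTail_sub_le τ hδ.le
  have h4 := (abs_le.1 key).2
  rw [normalTailAt, if_neg (not_le.2 hV)]
  change _ ≤ normalTail τ + ε
  have : B / δ ^ 3 * (1 + normalThirdMoment) * r = C * r := rfl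
  linarith

/-! ### Order statistics and exchange of index sets -/

theorem IsKSmallest.le_of_orderStat_le {I : ℕ} {x : Fin I → ℝ≥0∞} {k : ℕ} {K : Finset (Fin I)}
    (hK : IsKSmallest x k K) (hk : 1 ≤ k) (hkI : k ≤ I) {Γ : ℝ≥0∞} (h : orderStat x k ≤ Γ)
    {i : Fin I} (hi : i ∈ K) : x i ≤ Γ := by
  classical
  by_contra hlt
  push Not at hlt
  have hk1 : k - 1 < I := by omega
  rw [orderStat, dif_pos hk1] at h
  -- Positions `0, …, k - 1` of the sorted vector give `k` indices with value at most `Γ`. They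
  -- would all lie in `K` without `i`, which has only `k - 1` elements.
  have hsub : (Finset.Iic (⟨k - 1, hk1⟩ : Fin I)).image (Tuple.sort x) ⊆ K.erase i := by
    intro j hj
    obtain ⟨l, hl, rfl⟩ := Finset.mem_image.1 hj
    have hle : x (Tuple.sort x l) ≤ Γ :=
      (Tuple.monotone_sort x (Finset.mem_Iic.1 hl)).trans h
    refine Finset.mem_erase.2 ⟨fun he => ?_, by_contra fun hn => ?_⟩
    · rw [he] at hle
      exact absurd hlt (not_lt.2 hle)
    · exact absurd hlt (not_lt.2 ((hK.2 i hi _ hn).trans hle))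
  have hcard := Finset.card_le_card hsub
  rw [Finset.card_image_of_injective _ (Tuple.sort x).injective, Fin.card_Iic,
    Finset.card_erase_of_mem hi, hK.1] at hcard
  simp only at hcard
  omega

/-- The two set differences have equal size, so each element occurs equally often in the double sum.
This converts differences of totals into the pairwise sums of condition 3. -/
theorem Finset.card_mul_sum_sub_sum {ι : Type*} [DecidableEq ι] {J K : Finset ι}
    (h : J.card = K.card) (f : ι → ℝ) :
    ((J \ K).card : ℝ) * (∑ i ∈ K, f i - ∑ i ∈ J, f i) =
      ∑ x ∈ (J \ K) ×ˢ (K \ J), (f x.2 - f x.1) := by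
  have hc : (K \ J).card = (J \ K).card := Finset.card_sdiff_comm h.symm
  rw [Finset.sum_sub_distrib, Finset.sum_product, Finset.sum_product_right]
  simp only [Finset.sum_const, nsmul_eq_mul, hc]
  rw [← mul_sub, ← Finset.sum_sdiff_sub_sum_sdiff]

theorem Finset.eq_of_card_sdiff_eq_zero {ι : Type*} [DecidableEq ι] {J K : Finset ι}
    (h : J.card = K.card) (h0 : (J \ K).card = 0) : J = K :=
  Finset.eq_of_subset_of_card_le (Finset.sdiff_eq_empty_iff_subset.1 (Finset.card_eq_zero.1 h0)) h.ge

/-! ### Randomization tails under the bounded null -/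

namespace MatchedStudy

variable {I : ℕ} (S : MatchedStudy I)

theorem law_nonneg (a : S.Assignment) : 0 ≤ S.law a :=
  Finset.prod_nonneg fun i _ => (S.isProbVec_p i).1 _

theorem prob_nonneg (E : Set S.Assignment) : 0 ≤ S.prob E :=
  Finset.sum_nonneg fun a _ => Set.indicator_nonneg (fun a _ => S.law_nonneg a) a

theorem prob_mono {E F : Set S.Assignment} (h : E ⊆ F) : S.prob E ≤ S.prob F :=
  Finset.sum_le_sum fun a _ => Set.indicator_le_indicator_of_subset h S.law_nonneg a

theorem prob_union_le (E F : Set S.Assignment) : S.prob (E ∪ F) ≤ S.prob E + S.prob F := by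
  classical
  rw [prob, prob, prob, ← Finset.sum_add_distrib]
  refine Finset.sum_le_sum fun a _ => ?_
  have := S.law_nonneg a
  by_cases h1 : a ∈ E <;> by_cases h2 : a ∈ F <;> simp [Set.indicator, h1, h2, this]

/-- Take the assignment with smallest `X` in the event: the event is contained in its upper tail,
whose probability is at most `β`. -/
theorem prob_tail_le (X : S.Assignment → ℝ) {β : ℝ} (hβ : 0 ≤ β) :
    S.prob {a | S.prob {b | X a ≤ X b} ≤ β} ≤ β := by
  rcases Set.eq_empty_or_nonempty {a | S.prob {b | X a ≤ X b} ≤ β} with h | h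
  · rw [h]
    simpa [prob] using hβ
  · obtain ⟨a, ha, hmin⟩ := Set.exists_min_image _ X (Set.toFinite _) h
    exact (S.prob_mono fun b hb => hmin b hb).trans ha

theorem stat_eq (q : S.Scores) (a : S.Assignment) (y : S.Outcome) :
    S.stat q a y = ∑ i, q y i (a i) := by
  simp [stat, z]

/-- The randomization p-value computed as if the observed outcomes were the control potential
outcomes dominates the exact randomization p-value of some fixed statistic. -/
theorem exists_prob_tail_le {q : S.Scores} (hnull : S.BoundedNull)
    (hstat : S.EffectIncreasing q ∨ S.DifferentialIncreasing q) :
    ∃ X : S.Assignment → ℝ, ∀ a, S.prob {b | X a ≤ X b} ≤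
      S.prob {b | S.stat q a (S.observed a) ≤ S.stat q b (S.observed a)} := by
  rcases hstat with h | h
  -- Passing from the outcomes observed under `b` to those under `a` raises no unit untreated by `b`
  -- and lowers no unit treated by `b`, so the statistic at `b` does not decrease.
  · refine ⟨fun b => S.stat q b (S.observed b), fun a => S.prob_mono fun b hb => ?_⟩
    rw [Set.mem_ofPred_eq] at hb ⊢
    refine hb.trans ?_
    have e : S.observed a = S.observed b + S.z b * (S.z b * (S.observed a - S.observed b)) +
        (1 - S.z b) * ((1 - S.z b) * (S.observed a - S.observed b)) := by
      funext i j
      simp only [Pi.add_apply, Pi.mul_apply, Pi.sub_apply, Pi.one_apply, z]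
      split_ifs <;> ring
    conv_rhs => rw [e]
    refine h b (S.observed b) _ _ (fun i j => ?_) (fun i j => ?_)
    all_goals
      have := hnull i j
      simp only [Pi.mul_apply, Pi.sub_apply, Pi.one_apply, z, observed]
      split_ifs <;> linarith
  -- `S.Y0` arises from the outcomes observed under `a` by raising units treated by `a`, which
  -- increases the statistic at `a` at least as much as that at `b`.
  · refine ⟨fun b => S.stat q b S.Y0, fun a => S.prob_mono fun b hb => ?_⟩
    have e : S.Y0 = S.observed a + S.z a * (S.Y0 - S.Y1) := by
      funext i j
      simp only [Pi.add_apply, Pi.mul_apply, Pi.sub_apply, z, observed]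
      split_ifs <;> ring
    have := h b a (S.observed a) (S.Y0 - S.Y1) fun i j => sub_nonneg.2 (hnull i j)
    rw [← e] at this
    simp only [Set.mem_ofPred_eq] at hb ⊢
    linarith

/-! ### From the true law to the bounds on the least biased sets -/

variable (q : S.Scores) (y : S.Outcome)

theorem n_pos (i : Fin I) : 0 < S.n i := (S.two_le_n i).trans_lt' two_pos

theorem infoSum_nonneg : 0 ≤ S.infoSum q y :=
  Finset.sum_nonneg fun _ _ => mul_nonneg (sq_nonneg _) ENNReal.toReal_nonneg

theorem infoSum_le : S.infoSum q y ≤ ∑ i, setVar (S.p i) (q y i) :=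
  Finset.sum_le_sum fun i _ => (S.isProbVec_p i).info_le_setVar _ (S.two_le_n i)

theorem infoSum_pos_of_lindebergRatio_le {η : ℝ} (h : S.lindebergRatio q y ≤ (η : EReal)) :
    0 < S.infoSum q y := by
  refine lt_of_le_of_ne (S.infoSum_nonneg q y) fun h0 => ?_
  rw [lindebergRatio, if_pos h0.symm] at h
  exact absurd h (not_le.2 (EReal.coe_lt_top η))

theorem setRange_sq_le_of_lindebergRatio_le {η : ℝ} (hη : 0 ≤ η)
    (h : S.lindebergRatio q y ≤ (η : EReal)) (i : Fin I) :
    setRange (q y i) ^ 2 ≤ η * ∑ i, setVar (S.p i) (q y i) := by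
  have h0 := S.infoSum_pos_of_lindebergRatio_le q y h
  rw [lindebergRatio, if_neg h0.ne', EReal.coe_le_coe_iff, div_le_iff₀ h0] at h
  exact (le_ciSup (f := fun i => setRange (q y i) ^ 2) (Set.finite_range _).bddAbove i).trans
    (h.trans (mul_le_mul_of_nonneg_left (S.infoSum_le q y) hη))

theorem prob_stat_eq (c : ℝ) : S.prob {b | c ≤ S.stat q b y} =
    ∑ a : ∀ i, Fin (S.n i), {a : ∀ i, Fin (S.n i) | c ≤ ∑ i, q y i (a i)}.indicator
      (fun a => ∏ i, S.p i (a i)) a := by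
  simp only [prob, stat_eq]
  rfl

theorem muOn_eq (Γ₀ : ℝ) (K : Finset (Fin I)) :
    S.muOn q y Γ₀ K = ∑ i, maxMean (q y i) (boundVec Γ₀ K i) := by
  classical
  rw [muOn, ← Finset.sum_add_sum_compl K]
  congr 1
  · exact Finset.sum_congr rfl fun i hi => by rw [boundVec, if_pos hi]
  · exact Finset.sum_congr rfl fun i hi => by rw [boundVec, if_neg (Finset.mem_compl.1 hi)]

theorem varOn_eq (Γ₀ : ℝ) (K : Finset (Fin I)) :
    S.varOn q y Γ₀ K = ∑ i, maxVar (q y i) (boundVec Γ₀ K i) := by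
  classical
  rw [varOn, ← Finset.sum_add_sum_compl K]
  congr 1
  · exact Finset.sum_congr rfl fun i hi => by rw [boundVec, if_pos hi]
  · exact Finset.sum_congr rfl fun i hi => by rw [boundVec, if_neg (Finset.mem_compl.1 hi)]

theorem varOn_eq_sum (Γ₀ : ℝ) (K : Finset (Fin I)) :
    S.varOn q y Γ₀ K = ∑ i ∈ K, maxVar (q y i) (ENNReal.ofReal Γ₀) := by
  rw [varOn, add_eq_left]
  exact Finset.sum_eq_zero fun i _ => maxVar_top (S.n_pos i) _

theorem varOn_nonneg (Γ₀ : ℝ) (K : Finset (Fin I)) : 0 ≤ S.varOn q y Γ₀ K := by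
  rw [varOn_eq_sum]
  exact Finset.sum_nonneg fun i _ => maxVar_nonneg (S.n_pos i) _ _

theorem muOn_eq_sub (Γ₀ : ℝ) (K : Finset (Fin I)) :
    S.muOn q y Γ₀ K = ∑ i, maxMean (q y i) ⊤ - ∑ i ∈ K, S.gap q y Γ₀ i := by
  rw [muOn, ← Finset.sum_add_sum_compl K]
  simp only [gap, Finset.sum_sub_distrib]
  ring

variable {Γ₀ : ℝ} {k : ℕ} {J K : Finset (Fin I)}

theorem mem_sensModels_boundVec (hΓ : 1 ≤ Γ₀) (hbias : ∀ i ∈ K, S.bias i ≤ ENNReal.ofReal Γ₀)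
    (i : Fin I) : S.p i ∈ SensModels (S.n i) (boundVec Γ₀ K i) := by
  rw [boundVec]
  split_ifs with h
  · exact (S.isProbVec_p i).mem_sensModels hΓ (hbias i h)
  · exact mem_sensModels_top.2 (S.isProbVec_p i)

theorem setMean_le_maxMean_boundVec (hΓ : 1 ≤ Γ₀)
    (hbias : ∀ i ∈ K, S.bias i ≤ ENNReal.ofReal Γ₀) (i : Fin I) :
    setMean (S.p i) (q y i) ≤ maxMean (q y i) (boundVec Γ₀ K i) :=
  setMean_le_maxMean (S.n_pos i) _ (S.mem_sensModels_boundVec hΓ hbias i)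

theorem sum_setMean_le_muOn (hΓ : 1 ≤ Γ₀) (hbias : ∀ i ∈ K, S.bias i ≤ ENNReal.ofReal Γ₀) :
    ∑ i, setMean (S.p i) (q y i) ≤ S.muOn q y Γ₀ K := by
  rw [muOn_eq]
  exact Finset.sum_le_sum fun i _ => S.setMean_le_maxMean_boundVec q y hΓ hbias i

/-- Sets outside `A` only reduce the variance deficit, while every set contributes a nonnegative
mean gain. So the ratio of averages over `A` controls the ratio of totals, the factor `1 / |A|`
cancelling. -/
theorem mul_sub_varOn_le (hΓ : 1 ≤ Γ₀) (hbias : ∀ i ∈ K, S.bias i ≤ ENNReal.ofReal Γ₀)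
    {M : ℝ} (hM : 0 ≤ M) (h : (M : EReal) < S.vecRatio q y (boundVec Γ₀ K))
    (hlt : S.varOn q y Γ₀ K < ∑ i, setVar (S.p i) (q y i)) :
    M * (∑ i, setVar (S.p i) (q y i) - S.varOn q y Γ₀ K) ≤
      √(∑ i, setVar (S.p i) (q y i)) * (S.muOn q y Γ₀ K - ∑ i, setMean (S.p i) (q y i)) := by
  classical
  rw [varOn_eq] at hlt
  rw [varOn_eq, muOn_eq, ← Finset.sum_sub_distrib, ← Finset.sum_sub_distrib]
  rw [← sub_pos, ← Finset.sum_sub_distrib] at hlt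
  set A := S.setA q y (boundVec Γ₀ K) with hA_def
  have hA : ∀ i, i ∈ A ↔ maxVar (q y i) (boundVec Γ₀ K i) < setVar (S.p i) (q y i) := by
    simp [hA_def, setA]
  have hv : ∑ i, (setVar (S.p i) (q y i) - maxVar (q y i) (boundVec Γ₀ K i)) ≤
      ∑ i ∈ A, (setVar (S.p i) (q y i) - maxVar (q y i) (boundVec Γ₀ K i)) := by
    rw [← Finset.sum_add_sum_compl A, add_le_iff_nonpos_right]
    refine Finset.sum_nonpos fun i hi => ?_
    have := Finset.mem_compl.1 hi
    rw [hA, not_lt] at this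
    linarith
  have hm0 : ∀ i, 0 ≤ maxMean (q y i) (boundVec Γ₀ K i) - setMean (S.p i) (q y i) := fun i =>
    sub_nonneg.2 (S.setMean_le_maxMean_boundVec q y hΓ hbias i)
  have hm : ∑ i ∈ A, (maxMean (q y i) (boundVec Γ₀ K i) - setMean (S.p i) (q y i)) ≤
      ∑ i, (maxMean (q y i) (boundVec Γ₀ K i) - setMean (S.p i) (q y i)) :=
    Finset.sum_le_sum_of_subset_of_nonneg (Finset.subset_univ _) fun i _ _ => hm0 i
  have hne : A ≠ ∅ := by
    intro h0
    rw [h0, Finset.sum_empty] at hv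
    linarith
  have hcard : ((A.card : ℝ))⁻¹ ≠ 0 := by
    simpa using hne
  rw [vecRatio, if_neg hne, EReal.coe_lt_coe_iff, deltaMu, deltaVar,
    mul_div_mul_left _ _ hcard, div_mul_eq_mul_div, lt_div_iff₀ (hlt.trans_le hv)] at h
  calc _ ≤ _ := mul_le_mul_of_nonneg_left hv hM
    _ ≤ _ := h.le
    _ ≤ (∑ i, (maxMean (q y i) (boundVec Γ₀ K i) - setMean (S.p i) (q y i))) *
        √(∑ i, setVar (S.p i) (q y i)) :=
      mul_le_mul hm (Real.sqrt_le_sqrt (S.infoSum_le q y)) (Real.sqrt_nonneg _)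
        (Finset.sum_nonneg fun i _ => hm0 i)
    _ = _ := mul_comm _ _

/-! ### From the least biased sets to the selected sets -/

variable {S q y}

theorem IsSelected.gap_le (hJ : S.IsSelected q y Γ₀ k J) {i j : Fin I} (hi : i ∈ J) (hj : j ∉ J) :
    S.gap q y Γ₀ i ≤ S.gap q y Γ₀ j := by
  rcases hJ.2 i hi j hj with h | h
  · exact h.le
  · exact h.1.le

theorem IsSelected.gap_sub_nonneg (hJ : S.IsSelected q y Γ₀ k J) {x : Fin I × Fin I}
    (hx : x ∈ (J \ K) ×ˢ (K \ J)) : 0 ≤ S.gap q y Γ₀ x.2 - S.gap q y Γ₀ x.1 := by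
  rw [Finset.mem_product, Finset.mem_sdiff, Finset.mem_sdiff] at hx
  exact sub_nonneg.2 (hJ.gap_le hx.1.1 hx.2.2)

/-- Maximizing the mean amounts to minimizing the total gap, and every exchange of an index of `J`
for one outside costs a nonnegative gap difference. -/
theorem IsSelected.muOn_le (hJ : S.IsSelected q y Γ₀ k J) (hK : K.card = k) :
    S.muOn q y Γ₀ K ≤ S.muOn q y Γ₀ J := by
  have hc : J.card = K.card := hJ.1.trans hK.symm
  rcases Nat.eq_zero_or_pos (J \ K).card with h0 | h0
  · rw [Finset.eq_of_card_sdiff_eq_zero hc h0]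
  · have h := Finset.card_mul_sum_sub_sum hc (S.gap q y Γ₀)
    have h1 : 0 ≤ ((J \ K).card : ℝ) * (∑ i ∈ K, S.gap q y Γ₀ i - ∑ i ∈ J, S.gap q y Γ₀ i) := by
      rw [h]
      exact Finset.sum_nonneg fun x hx => hJ.gap_sub_nonneg hx
    have h2 := nonneg_of_mul_nonneg_right h1 (by exact_mod_cast h0)
    rw [muOn_eq_sub, muOn_eq_sub]
    linarith

theorem IsSelected.muK_eq (hJ : S.IsSelected q y Γ₀ k J) :
    S.muK q y Γ₀ k = S.muOn q y Γ₀ J := by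
  refine IsGreatest.csSup_eq ⟨⟨J, hJ.1, rfl⟩, ?_⟩
  rintro _ ⟨K, hK, rfl⟩
  exact hJ.muOn_le hK

theorem IsSelected.varOn_le_varK (hJ : S.IsSelected q y Γ₀ k J) :
    S.varOn q y Γ₀ J ≤ S.varK q y Γ₀ k := by
  refine le_csSup (((Set.finite_range (S.varOn q y Γ₀)).subset ?_).bddAbove)
    ⟨J, hJ.1, hJ.muK_eq.symm, rfl⟩
  rintro _ ⟨K, -, -, rfl⟩
  exact ⟨K, rfl⟩

theorem IsSelected.mul_varOn_sub_le (hJ : S.IsSelected q y Γ₀ k J) (hK : K.card = k)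
    (hΓ : 1 ≤ Γ₀) {M : ℝ} (hM : 0 ≤ M) (h : (M : EReal) < S.selRatio q y Γ₀ J K)
    (hlt : S.varOn q y Γ₀ J < S.varOn q y Γ₀ K) :
    M * (S.varOn q y Γ₀ K - S.varOn q y Γ₀ J) ≤
      √(S.varOn q y Γ₀ K) * (S.muOn q y Γ₀ J - S.muOn q y Γ₀ K) := by
  classical
  have hc : J.card = K.card := hJ.1.trans hK.symm
  have hm0 : 0 < ((J \ K).card : ℝ) := by
    rw [Nat.cast_pos, Nat.pos_iff_ne_zero]
    intro h0
    rw [Finset.eq_of_card_sdiff_eq_zero hc h0] at hlt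
    exact lt_irrefl _ hlt
  have hinfo : ∑ i ∈ K, setRange (q y i) ^ 2 / ((S.n i : ℝ) * Γ₀) ^ 3 ≤ S.varOn q y Γ₀ K := by
    rw [varOn_eq_sum]
    exact Finset.sum_le_sum fun i _ => setRange_sq_div_le_maxVar (S.two_le_n i) _ hΓ
  have hg := Finset.card_mul_sum_sub_sum hc (S.gap q y Γ₀)
  have hv := Finset.card_mul_sum_sub_sum hc fun i => maxVar (q y i) (ENNReal.ofReal Γ₀)
  rw [← varOn_eq_sum, ← varOn_eq_sum] at hv
  have hgap : ∑ i ∈ K, S.gap q y Γ₀ i - ∑ i ∈ J, S.gap q y Γ₀ i =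
      S.muOn q y Γ₀ J - S.muOn q y Γ₀ K := by
    rw [muOn_eq_sub, muOn_eq_sub]
    ring
  rw [hgap] at hg
  set B := S.setB q y Γ₀ J K with hB_def
  have hBsub : B ⊆ (J \ K) ×ˢ (K \ J) := Finset.filter_subset _ _
  -- Pairs outside `B` contribute nonpositive variance differences; below, all pairs have
  -- nonnegative gap differences, so restricting to `B` is favourable on both sides.
  have hvB : ((J \ K).card : ℝ) * (S.varOn q y Γ₀ K - S.varOn q y Γ₀ J) ≤
      ∑ x ∈ B, (maxVar (q y x.2) (ENNReal.ofReal Γ₀) - maxVar (q y x.1) (ENNReal.ofReal Γ₀)) := by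
    rw [hv, ← Finset.sum_sdiff hBsub, add_le_iff_nonpos_left]
    refine Finset.sum_nonpos fun x hx => ?_
    rw [Finset.mem_sdiff, hB_def, setB, Finset.mem_filter, not_and, not_lt] at hx
    exact sub_nonpos.2 (hx.2 hx.1)
  have hgB : ∑ x ∈ B, (S.gap q y Γ₀ x.2 - S.gap q y Γ₀ x.1) ≤
      ((J \ K).card : ℝ) * (S.muOn q y Γ₀ J - S.muOn q y Γ₀ K) := by
    rw [hg]
    exact Finset.sum_le_sum_of_subset_of_nonneg hBsub fun x hx _ => hJ.gap_sub_nonneg hx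
  have hpos := (mul_pos hm0 (sub_pos.2 hlt)).trans_le hvB
  have hne : B ≠ ∅ := by
    intro h0
    rw [h0, Finset.sum_empty] at hpos
    exact lt_irrefl _ hpos
  have hcard : ((B.card : ℝ))⁻¹ ≠ 0 := by
    simpa using hne
  rw [selRatio, if_neg hne, EReal.coe_lt_coe_iff, deltaMuB, deltaVarB,
    mul_div_mul_left _ _ hcard, div_mul_eq_mul_div, lt_div_iff₀ hpos] at h
  refine le_of_mul_le_mul_left ?_ hm0
  calc ((J \ K).card : ℝ) * (M * (S.varOn q y Γ₀ K - S.varOn q y Γ₀ J))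
      = M * (((J \ K).card : ℝ) * (S.varOn q y Γ₀ K - S.varOn q y Γ₀ J)) := by ring
    _ ≤ _ := mul_le_mul_of_nonneg_left hvB hM
    _ ≤ _ := h.le
    _ ≤ (((J \ K).card : ℝ) * (S.muOn q y Γ₀ J - S.muOn q y Γ₀ K)) * √(S.varOn q y Γ₀ K) :=
      mul_le_mul hgB (Real.sqrt_le_sqrt hinfo) (Real.sqrt_nonneg _)
        (mul_nonneg hm0.le (sub_nonneg.2 (hJ.muOn_le hK)))
    _ = _ := by ring

/-! ### Assembling the normal bound and passing to the limit -/

/-- Normal approximation of the tail of the statistic by the tail of the worst-case normal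
distribution. -/
theorem exists_prob_stat_le_gaussianReal {ε : ℝ} (hε : 0 < ε) : ∃ η M : ℝ, 0 < η ∧
    ∀ {I : ℕ} (S : MatchedStudy I) (q : S.Scores) (y : S.Outcome) (Γ₀ : ℝ) (k : ℕ)
      (J K : Finset (Fin I)) (_ : 1 ≤ Γ₀) (_ : ∀ i ∈ K, S.bias i ≤ ENNReal.ofReal Γ₀)
      (_ : K.card = k) (_ : S.IsSelected q y Γ₀ k J) (_ : S.lindebergRatio q y ≤ (η : EReal))
      (_ : (M : EReal) < S.vecRatio q y (boundVec Γ₀ K))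
      (_ : (M : EReal) < S.selRatio q y Γ₀ J K) (c : ℝ) (_ : S.muK q y Γ₀ k ≤ c),
      S.prob {b | c ≤ S.stat q b y} ≤
        (gaussianReal (S.muK q y Γ₀ k) (S.varK q y Γ₀ k).toNNReal).real (Set.Ici c) + 3 * ε := by
  obtain ⟨η, hη, hclt⟩ := exists_tail_le_normalTailAt hε
  obtain ⟨M, hM, htail⟩ := exists_normalTail_le hε
  refine ⟨η, M, hη, ?_⟩
  intro I S q y Γ₀ k J K hΓ hbias hK hJ hL hvec hsel c hc
  have h1 := hclt S.isProbVec_p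
    ((S.infoSum_pos_of_lindebergRatio_le q y hL).trans_le (S.infoSum_le q y))
    (S.setRange_sq_le_of_lindebergRatio_le q y hη.le hL) c
  rw [← prob_stat_eq] at h1
  rw [hJ.muK_eq] at hc ⊢
  have hKc := (hJ.muOn_le hK).trans hc
  -- The three errors `ε` come from the central limit theorem and from `normalTail M` in each of the
  -- two comparisons.
  have h2 := normalTailAt_compare (S.sum_setMean_le_muOn q y hΓ hbias) hKc hM.le
    (S.varOn_nonneg q y Γ₀ K) (S.mul_sub_varOn_le q y hΓ hbias hM.le hvec)
  have h3 := normalTailAt_compare (hJ.muOn_le hK) hc hM.le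
    (S.varOn_nonneg q y Γ₀ J) (hJ.mul_varOn_sub_le hK hΓ hM.le hsel)
  have h4 := normalTailAt_mono_var hc hJ.varOn_le_varK
  have h5 := normalTailAt_le_gaussianReal (S.muOn q y Γ₀ J) (S.varK q y Γ₀ k) c
  linarith

end MatchedStudy

theorem theoremA4
    (S : ∀ I : ℕ, MatchedStudy I) (q : ∀ I, (S I).Scores)
    (k : ℕ → ℕ) (hk : ∀ I, 1 ≤ I → 1 ≤ k I ∧ k I ≤ I)
    (Γ₀ : ℕ → ℝ) (hΓ₀ : ∀ I, 1 ≤ Γ₀ I)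
    (hnull : ∀ I, (S I).BoundedNull)
    (hbias : ∀ I, 1 ≤ I → orderStat (S I).bias (k I) ≤ ENNReal.ofReal (Γ₀ I))
    (K : ∀ I, Finset (Fin I)) (hK : ∀ I, 1 ≤ I → IsKSmallest (S I).bias (k I) (K I))
    (J : ∀ I, (S I).Outcome → Finset (Fin I))
    (hJ : ∀ I, 1 ≤ I → ∀ y, (S I).IsSelected (q I) y (Γ₀ I) (k I) (J I y))
    (hreg : RegularInProb S q Γ₀ K J)
    (hstat : ∀ I, (S I).EffectIncreasing (q I) ∨ (S I).DifferentialIncreasing (q I))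
    (α : ℝ) (hα : α ∈ Set.Ioo (0 : ℝ) 1) :
    limsup (fun I => (S I).prob {a | (S I).pValue (q I) (Γ₀ I) (k I) a ≤ α}) atTop ≤ α := by
  refine le_of_forall_pos_le_add fun ε hε => ?_
  refine limsup_le_of_le (isCoboundedUnder_le_of_le atTop fun I => (S I).prob_nonneg _) ?_
  have hε6 : 0 < ε / 6 := by positivity
  obtain ⟨η, M, hη, hmain⟩ := MatchedStudy.exists_prob_stat_le_gaussianReal hε6
  filter_upwards [(hreg.lindeberg η hη).eventually_le_const hε6,
    (hreg.trueSets M).eventually_le_const hε6, (hreg.selectedSets M).eventually_le_const hε6,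
    eventually_ge_atTop 1] with I hlin htrue hsel hI
  obtain ⟨X, hX⟩ := (S I).exists_prob_tail_le (hnull I) (hstat I)
  have htail := (S I).prob_tail_le X (β := α + 3 * (ε / 6)) (by linarith [hα.1])
  set E₁ := {a | (η : EReal) < (S I).lindebergRatio (q I) ((S I).observed a)}
  set E₂ := {a | (S I).vecRatio (q I) ((S I).observed a)
    (MatchedStudy.boundVec (Γ₀ I) (K I)) ≤ (M : EReal)}
  set E₃ := {a | (S I).selRatio (q I) ((S I).observed a) (Γ₀ I)
    (J I ((S I).observed a)) (K I) ≤ (M : EReal)}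
  set E₄ := {a | (S I).prob {b | X a ≤ X b} ≤ α + 3 * (ε / 6)}
  -- Off the three exceptional events, a small p-value forces a small exact tail of `X`. The
  -- probabilities add up to at most `3 * (ε / 6) + (α + 3 * (ε / 6)) = α + ε`.
  have hsub : {a | (S I).pValue (q I) (Γ₀ I) (k I) a ≤ α} ⊆ E₁ ∪ (E₂ ∪ (E₃ ∪ E₄)) := by
    intro a ha
    by_contra hn
    simp only [Set.mem_union, not_or] at hn
    obtain ⟨h1, h2, h3, h4⟩ := hn
    simp only [E₁, E₂, E₃, Set.mem_ofPred_eq, not_lt, not_le] at h1 h2 h3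
    refine h4 ((hX a).trans ?_)
    simp only [Set.mem_ofPred_eq, MatchedStudy.pValue] at ha
    split_ifs at ha with hT
    · exact (hmain (S I) (q I) _ (Γ₀ I) (k I) _ (K I) (hΓ₀ I)
        (fun i hi => (hK I hI).le_of_orderStat_le (hk I hI).1 (hk I hI).2 (hbias I hI) hi)
        (hK I hI).1 (hJ I hI _) h1 h2 h3 _ hT).trans (by linarith)
    · linarith [hα.2]
  have hu1 := (S I).prob_union_le E₁ (E₂ ∪ (E₃ ∪ E₄))
  have hu2 := (S I).prob_union_le E₂ (E₃ ∪ E₄)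
  have hu3 := (S I).prob_union_le E₃ E₄
  have := (S I).prob_mono hsub
  linarith
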